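/- **Setting.** For a finite graph $\mathcal G=(V,E)$ and $\beta>0$, the Ising model on $\mathcal G$ assigns to $\sigma\in\{-1,+1\}^V$ the probability $\frac{1}{Z^{\mathcal G}_\beta}\exp\big(\beta\sum_{xy\in E}\sigma_x\sigma_y\big)$, where $Z^{\mathcal G}_\beta$ is the normalising constant; write $\langle\cdot\rangle_\beta^{\mathcal G}$ for its expectation. Let $d\ge1$. For an integer $R\ge1$ let $\Lambda_R=[-R/2,R/2)^d\cap\mathbb Z^d$ with its nearest-neighbour edges, and for an integer $r\ge3$ let $\mathbb T_r=(\mathbb Z/r\mathbb Z)^d$ with its nearest-neighbour edges. Let $\pi:\mathbb Z^d\to\mathbb T_r$ be the projection, identify $x\in\mathbb T_r$ with its representative in $\Lambda_r$, and write $x\cong x'$ if $x-x'\in r\mathbb Z^d$. Put $$\tau_\beta^{\mathbb T_r}(x)=\langle\sigma_0\sigma_x\rangle_\beta^{\mathbb T_r}\quad(x\in\mathbb T_r),\qquad \tau_\beta(x)=\lim_{R\to\infty}\langle\sigma_0\sigma_x\rangle_\beta^{\Lambda_R}\quad(x\in\mathbb Z^d),\qquad T_\beta^{(r)}(x)=\sum_{u\in\mathbb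 Z^d}\tau_\beta(x+ru).$$ (The limit exists, and all two-point functions are nonnegative, by the Griffiths inequalities.) Infinite sums take values in $[0,\infty]$, and $\infty-a=\infty$ for finite $a$. **Theorem 2.1.** Let $d\ge1$, $r\ge3$ and $\beta>0$. For any $x\in\mathbb T_r$, $$\tau_\beta^{\mathbb T_r}(x)\le T_\beta^{(r)}(x),$$ $$T_\beta^{(r)}(x)-\tau_\beta^{\mathbb T_r}(x)\le\sum_{x'\cong x}\ \sum_{y}\ \sum_{\substack{y'\cong y\\ y'\ne y}}\ \sum_{z}\ \tau_\beta(z)\,\tau_\beta(y-z)\,\tau_\beta(y'-z)\,\tau_\beta^{\mathbb T_r}(\pi y'-\pi z)\,\tau_\beta(x'-y),$$ where $x',y,y',z$ range over $\mathbb Z^d$ with the indicated restrictions. -/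

import Mathlib

open Filter
open scoped BigOperators ENNReal

noncomputable section

namespace IsingTorus

/-! ### The Ising model on a finite graph -/

section FiniteGraph

variable {V : Type*} [Fintype V]

/-- Product `σ_x σ_y` of the two spins at the end points of an edge `e = xy`. -/
def edgeSpin (σ : V → ℤˣ) (e : Sym2 V) : ℝ :=
  Sym2.lift ⟨fun x y => ((σ x : ℤ) : ℝ) * ((σ y : ℤ) : ℝ), fun _ _ => mul_comm _ _⟩ e

open Classical in
/-- The Hamiltonian `H(σ) = - ∑_{xy ∈ E} σ_x σ_y` (each unordered edge counted once). -/
def hamiltonian (G : SimpleGraph V) (σ : V → ℤˣ) : ℝ :=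
  -∑ e ∈ G.edgeFinset, edgeSpin σ e

open Classical in
/-- The partition function; a spin configuration is a map `V → ℤˣ = {1, -1}`. -/
def partitionFunction (G : SimpleGraph V) (β : ℝ) : ℝ :=
  ∑ σ : V → ℤˣ, Real.exp (-β * hamiltonian G σ)

open Classical in
/-- The Ising expectation `⟨F⟩` on the finite graph `G` at inverse temperature `β`. -/
def expectation (G : SimpleGraph V) (β : ℝ) (F : (V → ℤˣ) → ℝ) : ℝ :=
  (1 / partitionFunction G β) * ∑ σ : V → ℤˣ, F σ * Real.exp (-β * hamiltonian G σ)

/-- The two-point function `⟨σ_x σ_y⟩` on the finite graph `G`. -/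
def twoPoint (G : SimpleGraph V) (β : ℝ) (x y : V) : ℝ :=
  expectation G β fun σ => ((σ x : ℤ) : ℝ) * ((σ y : ℤ) : ℝ)

end FiniteGraph

/-! ### Boxes, the torus, and infinite volume -/

/-- The nearest-neighbour graph on `A^d`: distinct points that differ by a standard unit vector.
It is used for `A = ℤ` (the lattice) and `A = ℤ/rℤ` (the torus). -/
def nnGraph (A : Type*) [CommRing A] (d : ℕ) : SimpleGraph (Fin d → A) :=
  SimpleGraph.fromRel fun x y => ∃ i : Fin d, y = x + Pi.single i 1

/-- The box `Λ_R = [-R/2, R/2)^d ∩ ℤ^d`. -/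
def box (d R : ℕ) : Finset (Fin d → ℤ) :=
  Fintype.piFinset fun _ => Finset.Ico ⌈-(R : ℝ) / 2⌉ ⌈(R : ℝ) / 2⌉

theorem mem_box {d R : ℕ} {x : Fin d → ℤ} :
    x ∈ box d R ↔ ∀ i, -(R : ℝ) / 2 ≤ (x i : ℝ) ∧ (x i : ℝ) < (R : ℝ) / 2 := by
  simp only [box, Fintype.mem_piFinset, Finset.mem_Ico, Int.ceil_le, Int.lt_ceil]

/-- The box with its nearest-neighbour edges (free boundary conditions). -/
def boxGraph (d R : ℕ) : SimpleGraph (box d R) :=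
  (nnGraph ℤ d).comap Subtype.val

open Classical in
/-- The two-point function of the box `Λ_R` with free boundary conditions, set to `0` when one of
the points lies outside of the box. -/
def boxTwoPoint (d R : ℕ) (β : ℝ) (x y : Fin d → ℤ) : ℝ :=
  if h : x ∈ box d R ∧ y ∈ box d R then twoPoint (boxGraph d R) β ⟨x, h.1⟩ ⟨y, h.2⟩ else 0

/-- The infinite-volume two-point function `τ_β(x) = lim_{R → ∞} τ_β^{Λ_R}(0, x)`. -/
def tau (d : ℕ) (β : ℝ) (x : Fin d → ℤ) : ℝ :=
  limUnder atTop fun R : ℕ => boxTwoPoint d R β 0 x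

/-- The torus two-point function `τ_β^{𝕋_r}(a) = ⟨σ_0 σ_a⟩`, for `a ∈ (ℤ/rℤ)^d`. -/
def torusTau (d r : ℕ) [NeZero r] (β : ℝ) (a : Fin d → ZMod r) : ℝ :=
  twoPoint (nnGraph (ZMod r) d) β 0 a

/-- The projection `π : ℤ^d → (ℤ/rℤ)^d`. -/
def proj (d r : ℕ) (x : Fin d → ℤ) : Fin d → ZMod r :=
  fun i => (x i : ZMod r)

/-- `x ≅ x'` if `x - x' ∈ r ℤ^d`. -/
def Equivalent {d : ℕ} (r : ℕ) (x x' : Fin d → ℤ) : Prop :=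
  ∃ u : Fin d → ℤ, x - x' = (r : ℤ) • u

/-- The unfolded sum `T_β^{(r)}(x) = ∑_{u ∈ ℤ^d} τ_β(x + r u)`, with values in `[0, ∞]`. -/
def unfolded (d r : ℕ) (β : ℝ) (x : Fin d → ℤ) : ℝ≥0∞ :=
  ∑' u : Fin d → ℤ, ENNReal.ofReal (tau d β (x + (r : ℤ) • u))

end IsingTorus

end

/-! Up to a constant, the Ising weight is `∏ (1 + t σ_e)` over the edges `e`, with `t = tanh β`. Let
`r ∣ M`, so that the torus of side `M` covers the torus of side `r`. Put independent Ising models on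
both and explore them jointly from the origin, pairing an edge at an explored vertex of the covering
with its image in the base. If `s` and `σ` are the two edge products, then `(1 + ts)(1 + tσ) = (1 -
t²) + t(1 + sσ)(t + s)`. The first term closes the edge; the second forces `sσ = 1`, so that the two
systems agree along whatever is explored. Both terms have nonnegative Fourier coefficients, so the
Griffiths inequalities hold on each branch.

When the exploration stops, no remaining base edge meets the projection of the explored set `K`. A
base vertex is then correlated with the origin only if it is `p k` with `k ∈ K`, and that
correlation equals the one of `o` with `k`. This gives the upper bound on the base two-point
function. The error comes from vertices `y` lying over the same point as another explored vertex
`y'`. By a Simon-type inequality (`sum_mul_sgn_mul_wt_le`), the unmatched points `x'` of the fibre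
are correlated with `o` only through such `y`, whence the factor `τ(x' - y)`. Cutting `K` out of the
covering gives `τ(y' - z) τ(y - z)` with `z` explored, and an explored `z` yields `τ(z)` times the
base correlation of `p y'` and `p z`. This is `corr_covering`.

Finally `M → ∞`. If `∑ τ` is finite, Simon's inequality on a box (`torusTau_le_add`) bounds the
two-point function of the large torus by the projection of `τ` plus a function of small total mass.
The error term is a finite sum of products of pair sums (`errorSum_eq`), which is stable under such
a perturbation. If the unfolded sum is infinite, so is the error (`errorSum_eq_top`). -/

noncomputable section

namespace IsingTorus

/-! ### Griffiths inequalities on a finite group of configurations -/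

section Cone

variable {Ω : Type*} [CommGroup Ω]

/-- A sign character, read as a real function. -/
def sgn (χ : Ω →* ℤˣ) (ω : Ω) : ℝ := ((χ ω : ℤ) : ℝ)

theorem sgn_mul (χ ψ : Ω →* ℤˣ) (ω : Ω) : sgn (χ * ψ) ω = sgn χ ω * sgn ψ ω := by
  simp [sgn]

theorem sgn_apply_mul (χ : Ω →* ℤˣ) (ω ρ : Ω) : sgn χ (ω * ρ) = sgn χ ω * sgn χ ρ := by
  simp [sgn]

theorem sgn_one_left (ω : Ω) : sgn (1 : Ω →* ℤˣ) ω = 1 := by simp [sgn]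

theorem sgn_apply_one (χ : Ω →* ℤˣ) : sgn χ (1 : Ω) = 1 := by simp [sgn]

theorem sgn_eq (χ : Ω →* ℤˣ) (ω : Ω) : sgn χ ω = 1 ∨ sgn χ ω = -1 := by
  rcases Int.units_eq_one_or (χ ω) with h | h <;> simp [sgn, h]

theorem sgn_mul_self (χ : Ω →* ℤˣ) (ω : Ω) : sgn χ ω * sgn χ ω = 1 := by
  rcases sgn_eq χ ω with h | h <;> simp [h]

theorem sgn_le_one (χ : Ω →* ℤˣ) (ω : Ω) : sgn χ ω ≤ 1 := by
  rcases sgn_eq χ ω with h | h <;> simp [h]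

variable (Ω) in
/-- Nonnegative multiples of characters. -/
def monomials : Submonoid (Ω → ℝ) where
  carrier := {f | ∃ c : ℝ, 0 ≤ c ∧ ∃ χ : Ω →* ℤˣ, f = fun ω => c * sgn χ ω}
  one_mem' := ⟨1, zero_le_one, 1, by ext ω; simp [sgn_one_left]⟩
  mul_mem' := by
    rintro _ _ ⟨c, hc, χ, rfl⟩ ⟨c', hc', χ', rfl⟩
    refine ⟨c * c', mul_nonneg hc hc', χ * χ', ?_⟩
    ext ω
    simp only [Pi.mul_apply, sgn_mul]
    ring

variable (Ω) in
/-- Functions with nonnegative Fourier coefficients. -/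
def cone : Subsemiring (Ω → ℝ) := (monomials Ω).subsemiringClosure

theorem monomial_mem_cone {c : ℝ} (hc : 0 ≤ c) (χ : Ω →* ℤˣ) :
    (fun ω => c * sgn χ ω) ∈ cone Ω :=
  AddSubmonoid.subset_closure ⟨c, hc, χ, rfl⟩

theorem sgn_mem_cone (χ : Ω →* ℤˣ) : sgn χ ∈ cone Ω := by
  simpa using monomial_mem_cone zero_le_one χ

theorem const_mem_cone {c : ℝ} (hc : 0 ≤ c) : (fun _ => c) ∈ cone Ω := by
  simpa [sgn_one_left] using monomial_mem_cone hc (1 : Ω →* ℤˣ)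

theorem affine_mem_cone {c d : ℝ} (hc : 0 ≤ c) (hd : 0 ≤ d) (χ : Ω →* ℤˣ) :
    (fun ω => c + d * sgn χ ω) ∈ cone Ω :=
  add_mem (const_mem_cone hc) (monomial_mem_cone hd χ)

variable [Fintype Ω]

theorem sum_sgn_nonneg (χ : Ω →* ℤˣ) : 0 ≤ ∑ ω, sgn χ ω := by
  by_cases h : ∃ g, sgn χ g = -1
  · obtain ⟨g, hg⟩ := h
    have : ∑ ω, sgn χ ω = ∑ ω, sgn χ (g * ω) :=
      (Fintype.sum_equiv (Equiv.mulLeft g) _ _ fun _ => rfl).symm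
    simp only [sgn_apply_mul, hg, neg_mul, one_mul, Finset.sum_neg_distrib] at this
    linarith
  · push Not at h
    exact Finset.sum_nonneg fun ω _ => by
      rw [(sgn_eq χ ω).resolve_right (h ω)]
      exact zero_le_one

/-- First Griffiths inequality. -/
theorem sum_nonneg_of_mem_cone {F : Ω → ℝ} (hF : F ∈ cone Ω) : 0 ≤ ∑ ω, F ω := by
  -- Products of monomials are monomials, so the generated semiring is the additive closure.
  refine AddSubmonoid.closure_induction (motive := fun F _ => 0 ≤ ∑ ω, F ω) ?_ ?_ ?_ hF
  · rintro _ ⟨c, hc, χ, rfl⟩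
    rw [← Finset.mul_sum]
    exact mul_nonneg hc (sum_sgn_nonneg χ)
  · simp
  · intro f g _ _ hf hg
    simpa [Finset.sum_add_distrib] using add_nonneg hf hg

/-- Second Griffiths inequality: only one of the observables has to be a character, and the other
one may contain further weights. -/
theorem griffiths_second {ι : Type*} (E : Finset ι) (χ : ι → Ω →* ℤˣ) {t : ℝ} (ht0 : 0 ≤ t)
    (ht1 : t ≤ 1) (ψ : Ω →* ℤˣ) {F : Ω → ℝ} (hF : F ∈ cone Ω) :
    (∑ ω, F ω * ∏ i ∈ E, (1 + t * sgn (χ i) ω)) * (∑ ω, sgn ψ ω * ∏ i ∈ E, (1 + t * sgn (χ i) ω))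
      ≤ (∑ ω, F ω * sgn ψ ω * ∏ i ∈ E, (1 + t * sgn (χ i) ω))
        * (∑ ω, ∏ i ∈ E, (1 + t * sgn (χ i) ω)) := by
  set W : Ω → ℝ := fun ω => ∏ i ∈ E, (1 + t * sgn (χ i) ω) with hW
  -- The difference of the two sides is a sum over two replicas `ω` and `ω' = ωρ`, in which `ψ(ω) -
  -- ψ(ω') = ψ(ω)(1 - ψ(ρ))`. It is nonnegative for each fixed `ρ`.
  have key : ∀ ρ : Ω, 0 ≤ (1 - sgn ψ ρ) * ∑ ω, F ω * sgn ψ ω * W ω * W (ω * ρ) := by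
    intro ρ
    refine mul_nonneg (sub_nonneg.2 (sgn_le_one _ _)) ?_
    -- For fixed `ρ`, `(1 + tχ(ω))(1 + tχ(ω)χ(ρ))` is affine in `χ(ω)` because `χ(ω)² = 1`, and its
    -- coefficients are nonnegative because `|t| ≤ 1`.
    have hmem : (F * sgn ψ * ∏ i ∈ E, fun ω => (1 + t ^ 2 * sgn (χ i) ρ)
        + t * (1 + sgn (χ i) ρ) * sgn (χ i) ω) ∈ cone Ω := by
      refine mul_mem (mul_mem hF (sgn_mem_cone ψ)) (prod_mem fun i _ => affine_mem_cone ?_ ?_ _)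
      · rcases sgn_eq (χ i) ρ with h | h <;> rw [h] <;> nlinarith
      · rcases sgn_eq (χ i) ρ with h | h <;> rw [h] <;> linarith
    refine (sum_nonneg_of_mem_cone hmem).trans_eq (Finset.sum_congr rfl fun ω _ => ?_)
    simp only [Pi.mul_apply, Finset.prod_apply, hW]
    rw [mul_assoc (F ω * sgn ψ ω), ← Finset.prod_mul_distrib]
    congr 1
    refine Finset.prod_congr rfl fun i _ => ?_
    rw [sgn_apply_mul]
    linear_combination (-t ^ 2 * sgn (χ i) ρ) * sgn_mul_self (χ i) ω
  have hshift : ∀ (G : Ω → ℝ) (ω : Ω), ∑ ρ, G (ω * ρ) = ∑ ρ, G ρ := fun G ω =>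
    Fintype.sum_equiv (Equiv.mulLeft ω) _ _ fun _ => rfl
  have hdiff : (∑ ω, F ω * sgn ψ ω * W ω) * (∑ ω, W ω) - (∑ ω, F ω * W ω) * (∑ ω, sgn ψ ω * W ω)
      = ∑ ρ, (1 - sgn ψ ρ) * ∑ ω, F ω * sgn ψ ω * W ω * W (ω * ρ) := by
    have hcomm : ∑ ρ, (1 - sgn ψ ρ) * ∑ ω, F ω * sgn ψ ω * W ω * W (ω * ρ)
        = ∑ ω, ∑ ρ, (1 - sgn ψ ρ) * (F ω * sgn ψ ω * W ω * W (ω * ρ)) := by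
      simp only [Finset.mul_sum]
      exact Finset.sum_comm
    rw [hcomm, Finset.sum_mul, Finset.sum_mul, ← Finset.sum_sub_distrib]
    refine Finset.sum_congr rfl fun ω _ => ?_
    rw [← hshift W ω, ← hshift (fun ρ => sgn ψ ρ * W ρ) ω, Finset.mul_sum, Finset.mul_sum,
      ← Finset.sum_sub_distrib]
    refine Finset.sum_congr rfl fun ρ _ => ?_
    rw [sgn_apply_mul]
    ring
  have := Finset.sum_nonneg fun ρ (_ : ρ ∈ Finset.univ) => key ρ
  rw [← hdiff] at this
  linarith

end Cone

/-! ### Correlations of spins coupled by a set of edges -/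

section Corr

variable {Ω : Type*} [CommGroup Ω] {V : Type*} (σ : V → Ω →* ℤˣ)

/-- Product of the two spins at the end points of an edge. -/
def edgeChar (e : Sym2 V) : Ω →* ℤˣ :=
  Sym2.lift ⟨fun x y => σ x * σ y, fun _ _ => mul_comm _ _⟩ e

@[simp] theorem edgeChar_mk (x y : V) : edgeChar σ s(x, y) = σ x * σ y := rfl

/-- High-temperature weight of a set of edges. -/
def wt (t : ℝ) (E : Finset (Sym2 V)) (ω : Ω) : ℝ := ∏ e ∈ E, (1 + t * sgn (edgeChar σ e) ω)

theorem wt_union [DecidableEq (Sym2 V)] (t : ℝ) {E E' : Finset (Sym2 V)} (h : Disjoint E E')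
    (ω : Ω) : wt σ t (E ∪ E') ω = wt σ t E ω * wt σ t E' ω := Finset.prod_union h

theorem wt_eq_mul_erase [DecidableEq (Sym2 V)] (t : ℝ) {E : Finset (Sym2 V)} {e : Sym2 V}
    (he : e ∈ E) (ω : Ω) :
    wt σ t E ω = (1 + t * sgn (edgeChar σ e) ω) * wt σ t (E.erase e) ω :=
  (Finset.mul_prod_erase E _ he).symm

variable {t : ℝ}

theorem wt_mem_cone (ht0 : 0 ≤ t) (E : Finset (Sym2 V)) : wt σ t E ∈ cone Ω := by
  have : wt σ t E = ∏ e ∈ E, fun ω => 1 + t * sgn (edgeChar σ e) ω := by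
    ext ω; simp [wt]
  rw [this]
  exact prod_mem fun e _ => affine_mem_cone zero_le_one ht0 _

theorem edgeChar_eq_one {g : Ω} {e : Sym2 V} (h : ∀ v ∈ e, σ v g = 1) : edgeChar σ e g = 1 := by
  induction e with
  | _ x y => simp [h x (Sym2.mem_mk_left x y), h y (Sym2.mem_mk_right x y)]

theorem wt_mul_of_fixed {g : Ω} {E : Finset (Sym2 V)} (h : ∀ e ∈ E, ∀ v ∈ e, σ v g = 1) (ω : Ω) :
    wt σ t E (g * ω) = wt σ t E ω := by
  refine Finset.prod_congr rfl fun e he => ?_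
  have : sgn (edgeChar σ e) g = 1 := by simp [sgn, edgeChar_eq_one σ (h e he)]
  rw [sgn_apply_mul, this, one_mul]

theorem wt_nonneg (ht0 : 0 ≤ t) (ht1 : t ≤ 1) (E : Finset (Sym2 V)) (ω : Ω) :
    0 ≤ wt σ t E ω :=
  Finset.prod_nonneg fun e _ => by
    rcases sgn_eq (edgeChar σ e) ω with h | h <;> rw [h] <;> linarith

variable [Fintype Ω]

theorem sum_wt_pos (ht0 : 0 ≤ t) (ht1 : t ≤ 1) (E : Finset (Sym2 V)) : 0 < ∑ ω, wt σ t E ω := by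
  refine Finset.sum_pos' (fun ω _ => wt_nonneg σ ht0 ht1 E ω) ⟨1, Finset.mem_univ _, ?_⟩
  exact Finset.prod_pos fun e _ => by rw [sgn_apply_one]; linarith

/-- Spin correlation of two vertices for the weight of a set of edges. -/
def corr (t : ℝ) (E : Finset (Sym2 V)) (a b : V) : ℝ :=
  (∑ ω, sgn (σ a * σ b) ω * wt σ t E ω) / ∑ ω, wt σ t E ω

theorem corr_comm (E : Finset (Sym2 V)) (a b : V) : corr σ t E a b = corr σ t E b a := by
  rw [corr, mul_comm (σ a), corr]

theorem corr_mul_sum_wt (ht0 : 0 ≤ t) (ht1 : t ≤ 1) (E : Finset (Sym2 V)) (a b : V) :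
    corr σ t E a b * ∑ ω, wt σ t E ω = ∑ ω, sgn (σ a * σ b) ω * wt σ t E ω :=
  div_mul_cancel₀ _ (sum_wt_pos σ ht0 ht1 E).ne'

theorem corr_nonneg (ht0 : 0 ≤ t) (ht1 : t ≤ 1) (E : Finset (Sym2 V)) (a b : V) :
    0 ≤ corr σ t E a b :=
  div_nonneg (sum_nonneg_of_mem_cone (mul_mem (sgn_mem_cone _) (wt_mem_cone σ ht0 E)))
    (sum_wt_pos σ ht0 ht1 E).le

theorem corr_self (ht0 : 0 ≤ t) (ht1 : t ≤ 1) (E : Finset (Sym2 V)) (a : V) :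
    corr σ t E a a = 1 := by
  rw [corr, div_eq_one_iff_eq (sum_wt_pos σ ht0 ht1 E).ne']
  simp [sgn_mul, sgn_mul_self]

theorem corr_le_one (ht0 : 0 ≤ t) (ht1 : t ≤ 1) (E : Finset (Sym2 V)) (a b : V) :
    corr σ t E a b ≤ 1 := by
  refine (div_le_one (sum_wt_pos σ ht0 ht1 E)).2 (Finset.sum_le_sum fun ω _ => ?_)
  exact mul_le_of_le_one_left (wt_nonneg σ ht0 ht1 E ω) (sgn_le_one _ _)

/-- Second Griffiths inequality for a correlation of an Ising model whose weight is a factor. -/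
theorem corr_mul_sum_le (ht0 : 0 ≤ t) (ht1 : t ≤ 1) (E : Finset (Sym2 V)) (a b : V) {F : Ω → ℝ}
    (hF : F ∈ cone Ω) :
    corr σ t E a b * ∑ ω, F ω * wt σ t E ω ≤ ∑ ω, F ω * sgn (σ a * σ b) ω * wt σ t E ω := by
  have h := griffiths_second E (edgeChar σ) ht0 ht1 (σ a * σ b) hF
  have hZ := sum_wt_pos σ ht0 ht1 E
  rw [corr, div_mul_eq_mul_div, div_le_iff₀ hZ, mul_comm]
  exact h

/-- The weight of the additional edges lies in the cone and serves as the observable in the second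
Griffiths inequality. -/
theorem corr_mono (ht0 : 0 ≤ t) (ht1 : t ≤ 1) {E E' : Finset (Sym2 V)} (h : E ⊆ E') (a b : V) :
    corr σ t E a b ≤ corr σ t E' a b := by
  classical
  have h1 := corr_mul_sum_le σ ht0 ht1 E a b (wt_mem_cone σ ht0 (E' \ E))
  have hw : ∀ ω, wt σ t (E' \ E) ω * wt σ t E ω = wt σ t E' ω := fun ω => by
    rw [← wt_union σ t Finset.sdiff_disjoint, Finset.sdiff_union_of_subset h]
  rw [corr.eq_def σ t E', le_div_iff₀ (sum_wt_pos σ ht0 ht1 E')]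
  simp only [hw] at h1
  refine h1.trans_eq (Finset.sum_congr rfl fun ω _ => ?_)
  rw [← hw ω]
  ring

theorem corr_mul_corr_le (ht0 : 0 ≤ t) (ht1 : t ≤ 1) (E : Finset (Sym2 V)) (a b c : V) :
    corr σ t E a b * corr σ t E b c ≤ corr σ t E a c := by
  have h1 := corr_mul_sum_le σ ht0 ht1 E a b (sgn_mem_cone (σ b * σ c))
  have hZ := sum_wt_pos σ ht0 ht1 E
  rw [corr.eq_def σ t E b c, corr.eq_def σ t E a c, ← mul_div_assoc]
  refine div_le_div_of_nonneg_right (h1.trans_eq (Finset.sum_congr rfl fun ω _ => ?_)) hZ.le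
  simp only [sgn_mul]
  linear_combination (sgn (σ a) ω * sgn (σ c) ω * wt σ t E ω) * sgn_mul_self (σ b) ω

/-- A correlation vanishes if the weight does not see one of the two vertices. -/
theorem sum_sgn_mul_eq_zero {χ : Ω →* ℤˣ} {g : Ω} (hχ : χ g = -1) {F : Ω → ℝ}
    (hF : ∀ ω, F (g * ω) = F ω) : ∑ ω, sgn χ ω * F ω = 0 := by
  have : ∑ ω, sgn χ ω * F ω = ∑ ω, sgn χ (g * ω) * F (g * ω) :=
    (Fintype.sum_equiv (Equiv.mulLeft g) _ _ fun _ => rfl).symm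
  have hg : sgn χ g = -1 := by simp [sgn, hχ]
  simp only [sgn_apply_mul, hg, hF, neg_mul, one_mul, Finset.sum_neg_distrib] at this
  linarith

theorem corr_eq_zero {E : Finset (Sym2 V)} {a b : V} {g : Ω} (hb : σ b g = -1)
    (hg : ∀ v, v ≠ b → σ v g = 1) (hab : a ≠ b) (hE : ∀ e ∈ E, b ∉ e) : corr σ t E a b = 0 := by
  rw [corr, sum_sgn_mul_eq_zero (g := g), zero_div]
  · simp [hg a hab, hb]
  · exact wt_mul_of_fixed σ fun e he v hv => hg v fun h => hE e he (h ▸ hv)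

/-- Effect of an edge at `a` on the correlations of `a`. -/
theorem corr_edge_mul [DecidableEq (Sym2 V)] (ht0 : 0 ≤ t) (ht1 : t ≤ 1) {E : Finset (Sym2 V)}
    {a u : V} (he : s(a, u) ∈ E) (b : V) :
    (1 + t * corr σ t (E.erase s(a, u)) a u) * corr σ t E a b
      = corr σ t (E.erase s(a, u)) a b + t * corr σ t (E.erase s(a, u)) u b := by
  set E' := E.erase s(a, u)
  have hZ' := sum_wt_pos σ ht0 ht1 E'
  have hZ := sum_wt_pos σ ht0 ht1 E
  have h1 : (1 + t * corr σ t E' a u) * ∑ ω, wt σ t E' ω = ∑ ω, wt σ t E ω := by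
    rw [add_mul, one_mul, mul_assoc, corr_mul_sum_wt σ ht0 ht1, Finset.mul_sum,
      ← Finset.sum_add_distrib]
    refine Finset.sum_congr rfl fun ω _ => ?_
    rw [wt_eq_mul_erase σ t he, edgeChar_mk]
    ring
  have h2 : (corr σ t E' a b + t * corr σ t E' u b) * ∑ ω, wt σ t E' ω
      = ∑ ω, sgn (σ a * σ b) ω * wt σ t E ω := by
    rw [add_mul, mul_assoc, corr_mul_sum_wt σ ht0 ht1, corr_mul_sum_wt σ ht0 ht1, Finset.mul_sum,
      ← Finset.sum_add_distrib]
    refine Finset.sum_congr rfl fun ω _ => ?_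
    rw [wt_eq_mul_erase σ t he, edgeChar_mk]
    simp only [sgn_mul]
    linear_combination (-t * sgn (σ u) ω * sgn (σ b) ω * wt σ t E' ω) * sgn_mul_self (σ a) ω
  have h3 := corr_mul_sum_wt σ ht0 ht1 E a b
  refine mul_right_cancel₀ hZ'.ne' ?_
  rw [h2, ← h3, ← h1]
  ring

end Corr

/-! ### Simon-type inequalities -/

section Simon

open scoped Classical

variable {Ω : Type*} [CommGroup Ω] [Fintype Ω] {V : Type*} (σ : V → Ω →* ℤˣ) {t : ℝ}

/-- The edges of `E` with both end points in `U`. -/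
def inside (E : Finset (Sym2 V)) (U : Set V) : Finset (Sym2 V) := E.filter fun e => ∀ v ∈ e, v ∈ U

theorem mem_inside {E : Finset (Sym2 V)} {U : Set V} {e : Sym2 V} :
    e ∈ inside E U ↔ e ∈ E ∧ ∀ v ∈ e, v ∈ U := Finset.mem_filter

theorem inside_subset (E : Finset (Sym2 V)) (U : Set V) : inside E U ⊆ E := Finset.filter_subset _ _

theorem sum_mul_wt_erase (E : Finset (Sym2 V)) {a u : V} (he : s(a, u) ∈ E) (F : Ω → ℝ) :
    ∑ ω, F ω * wt σ t E ω = ∑ ω, F ω * wt σ t (E.erase s(a, u)) ω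
      + t * ∑ ω, F ω * sgn (σ a * σ u) ω * wt σ t (E.erase s(a, u)) ω := by
  rw [Finset.mul_sum, ← Finset.sum_add_distrib]
  refine Finset.sum_congr rfl fun ω _ => ?_
  rw [wt_eq_mul_erase σ t he, edgeChar_mk]
  ring

/-- The edges outside `D` are absorbed into the observable. -/
theorem corr_mul_sum_le_of_subset (ht0 : 0 ≤ t) (ht1 : t ≤ 1) {D E : Finset (Sym2 V)} (h : D ⊆ E)
    (a b : V) {F : Ω → ℝ} (hF : F ∈ cone Ω) :
    corr σ t D a b * ∑ ω, F ω * wt σ t E ω ≤ ∑ ω, F ω * sgn (σ a * σ b) ω * wt σ t E ω := by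
  have hw : ∀ ω, wt σ t E ω = wt σ t (E \ D) ω * wt σ t D ω := fun ω => by
    rw [← wt_union σ t Finset.sdiff_disjoint, Finset.sdiff_union_of_subset h]
  have h1 := corr_mul_sum_le σ ht0 ht1 D a b (mul_mem hF (wt_mem_cone σ ht0 (E \ D)))
  simp only [Pi.mul_apply] at h1
  calc _ = corr σ t D a b * ∑ ω, F ω * wt σ t (E \ D) ω * wt σ t D ω := by
        simp only [hw, mul_assoc]
    _ ≤ _ := h1
    _ = _ := Finset.sum_congr rfl fun ω _ => by rw [hw]; ring

/-- The factor `1 + t * corr` is the one that `corr_edge_mul` produces when the same edge is removed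
from a correlation, so that the two cancel in the induction below. -/
theorem one_add_mul_sum_erase_le (ht0 : 0 ≤ t) (ht1 : t ≤ 1) {D E : Finset (Sym2 V)} {a u : V}
    (he : s(a, u) ∈ E) (h : D ⊆ E.erase s(a, u)) {F : Ω → ℝ} (hF : F ∈ cone Ω) :
    (1 + t * corr σ t D a u) * ∑ ω, F ω * wt σ t (E.erase s(a, u)) ω ≤ ∑ ω, F ω * wt σ t E ω := by
  rw [sum_mul_wt_erase σ E he]
  have := mul_le_mul_of_nonneg_left (corr_mul_sum_le_of_subset σ ht0 ht1 h a u hF) ht0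
  linarith

theorem sum_nonneg_mul_wt (ht0 : 0 ≤ t) (E : Finset (Sym2 V)) {F : Ω → ℝ} (hF : F ∈ cone Ω) :
    0 ≤ ∑ ω, F ω * wt σ t E ω :=
  sum_nonneg_of_mem_cone (mul_mem hF (wt_mem_cone σ ht0 E))

/-- Simon-type inequality: the spin at `a` is correlated to the rest of the system only through the
edges `E`, whose end points lie in `U` (where there is no other interaction) or in `Y`. -/
theorem sum_mul_sgn_mul_wt_le (ht0 : 0 ≤ t) (ht1 : t ≤ 1) (U : Set V)
    (Y : Finset V) {w : Ω → ℝ} (hw : w ∈ cone Ω)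
    (hflip : ∀ u ∈ U, ∃ g, σ u g = -1 ∧ (∀ v, v ≠ u → σ v g = 1) ∧ ∀ ω, w (g * ω) = w ω) (b : V)
    (E : Finset (Sym2 V)) (hE : ∀ e ∈ E, ∀ v ∈ e, v ∈ U ∨ v ∈ Y) {a : V} (ha : a ∈ U) :
    ∑ ω, w ω * sgn (σ a * σ b) ω * wt σ t E ω
      ≤ corr σ t (inside E U) a b * ∑ ω, w ω * wt σ t E ω
        + ∑ y ∈ Y, corr σ t E a y * ∑ ω, w ω * sgn (σ y * σ b) ω * wt σ t E ω := by
  -- Edges at `a` are removed one by one; an edge `s(a, u)` transfers part of the correlation from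
  -- `a` to `u`.
  induction hn : E.card using Nat.strong_induction_on generalizing E a with
  | _ n ih =>
    by_cases hex : ∃ u, s(a, u) ∈ E
    · obtain ⟨u, hu⟩ := hex
      set E' := E.erase s(a, u) with hE'
      have hE'E : E' ⊆ E := Finset.erase_subset _ _
      have hcard : E'.card < n := hn ▸ Finset.card_erase_lt_of_mem hu
      have hE'v : ∀ e ∈ E', ∀ v ∈ e, v ∈ U ∨ v ∈ Y := fun e he => hE e (hE'E he)
      have hΨ : ∀ y, w * sgn (σ y * σ b) ∈ cone Ω := fun y => mul_mem hw (sgn_mem_cone _)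
      have hpos : ∀ y, 0 ≤ ∑ ω, w ω * sgn (σ y * σ b) ω * wt σ t E' ω := fun y =>
        sum_nonneg_mul_wt σ ht0 E' (hΨ y)
      have hsplit : ∑ ω, w ω * sgn (σ a * σ b) ω * wt σ t E ω
          = ∑ ω, w ω * sgn (σ a * σ b) ω * wt σ t E' ω
            + t * ∑ ω, w ω * sgn (σ u * σ b) ω * wt σ t E' ω := by
        rw [sum_mul_wt_erase σ E hu]
        congr 2
        refine Finset.sum_congr rfl fun ω _ => ?_
        simp only [sgn_mul]
        linear_combination (w ω * sgn (σ b) ω * sgn (σ u) ω * wt σ t E' ω) *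
          sgn_mul_self (σ a) ω
      have hY : ∑ y ∈ Y, corr σ t E' a y * ∑ ω, w ω * sgn (σ y * σ b) ω * wt σ t E' ω
          + t * ∑ y ∈ Y, corr σ t E' u y * ∑ ω, w ω * sgn (σ y * σ b) ω * wt σ t E' ω
          ≤ ∑ y ∈ Y, corr σ t E a y * ∑ ω, w ω * sgn (σ y * σ b) ω * wt σ t E ω := by
        rw [Finset.mul_sum, ← Finset.sum_add_distrib]
        refine Finset.sum_le_sum fun y _ => ?_
        have h1 := corr_edge_mul σ ht0 ht1 hu y
        have h2 : (1 + t * corr σ t E' a u) * ∑ ω, w ω * sgn (σ y * σ b) ω * wt σ t E' ω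
            ≤ ∑ ω, w ω * sgn (σ y * σ b) ω * wt σ t E ω :=
          one_add_mul_sum_erase_le σ ht0 ht1 hu subset_rfl (hΨ y)
        have h3 := mul_le_mul_of_nonneg_left h2 (corr_nonneg σ ht0 ht1 E a y)
        refine le_trans (le_of_eq ?_) h3
        rw [← mul_assoc, ← mul_assoc, ← add_mul, ← h1]
        ring
      have iha := ih _ hcard E' hE'v ha rfl
      rw [hsplit]
      -- If `u ∈ U`, the induction hypotheses at `a` and `u` recombine through `corr_edge_mul`.
      -- Otherwise `u ∈ Y`, the edge does not count in `inside`, and the term of `u` is the summand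
      -- `y = u`, where `corr u u = 1`.
      by_cases huU : u ∈ U
      · have ihu := mul_le_mul_of_nonneg_left (ih _ hcard E' hE'v huU rfl) ht0
        have hmem : s(a, u) ∈ inside E U := by
          simp [mem_inside, hu, ha, huU]
        have hfe : (inside E U).erase s(a, u)
            = inside E' U := by
          rw [hE', inside, inside, Finset.filter_erase]
        have h1 := corr_edge_mul σ ht0 ht1 hmem b
        rw [hfe] at h1
        have h2 := one_add_mul_sum_erase_le σ ht0 ht1 hu
          (inside_subset E' U) hw
        have h3 := mul_le_mul_of_nonneg_left h2
          (corr_nonneg σ ht0 ht1 (inside E U) a b)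
        rw [mul_left_comm, ← mul_assoc, h1, add_mul] at h3
        linarith
      · have huY : u ∈ Y := (hE _ hu u (Sym2.mem_mk_right a u)).resolve_left huU
        have hfe : (inside E U) = inside E' U := by
          rw [hE', inside, inside, Finset.filter_erase, Finset.erase_eq_of_notMem]
          simp [huU]
        have h2 : ∑ ω, w ω * wt σ t E' ω ≤ ∑ ω, w ω * wt σ t E ω := by
          rw [sum_mul_wt_erase σ E hu]
          have : 0 ≤ ∑ ω, w ω * sgn (σ a * σ u) ω * wt σ t E' ω :=
            sum_nonneg_mul_wt σ ht0 E' (mul_mem hw (sgn_mem_cone _))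
          nlinarith
        have h3 := mul_le_mul_of_nonneg_left h2
          (corr_nonneg σ ht0 ht1 (inside E U) a b)
        have h4 : ∑ ω, w ω * sgn (σ u * σ b) ω * wt σ t E' ω
            ≤ ∑ y ∈ Y, corr σ t E' u y * ∑ ω, w ω * sgn (σ y * σ b) ω * wt σ t E' ω := by
          have := Finset.single_le_sum (f := fun y => corr σ t E' u y *
            ∑ ω, w ω * sgn (σ y * σ b) ω * wt σ t E' ω)
            (fun y _ => mul_nonneg (corr_nonneg σ ht0 ht1 E' u y) (hpos y)) huY
          simpa [corr_self σ ht0 ht1] using this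
        have h5 := mul_le_mul_of_nonneg_left h4 ht0
        rw [hfe] at h3 ⊢
        linarith
    · push Not at hex
      have hnn : 0 ≤ ∑ y ∈ Y, corr σ t E a y * ∑ ω, w ω * sgn (σ y * σ b) ω * wt σ t E ω :=
        Finset.sum_nonneg fun y _ => mul_nonneg (corr_nonneg σ ht0 ht1 E a y)
          (sum_nonneg_mul_wt σ ht0 E (mul_mem hw (sgn_mem_cone _)))
      by_cases hab : b = a
      · subst hab
        rw [corr_self σ ht0 ht1, one_mul]
        simpa [sgn_mul, sgn_mul_self] using hnn
      -- With no edge left at `a`, flipping the spin at `a` alone leaves the weight unchanged.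
      · obtain ⟨g, hg1, hg2, hg3⟩ := hflip a ha
        have h0 : ∑ ω, w ω * sgn (σ a * σ b) ω * wt σ t E ω = 0 := by
          have := sum_sgn_mul_eq_zero (χ := σ a * σ b) (g := g) (by simp [hg1, hg2 b hab])
            (F := fun ω => w ω * wt σ t E ω) fun ω => by
              rw [hg3, wt_mul_of_fixed σ]
              intro e he v hv
              refine hg2 v fun hva => ?_
              subst hva
              obtain ⟨u, rfl⟩ := hv
              exact hex u he
          rw [← this]
          exact Finset.sum_congr rfl fun ω _ => by ring
        rw [h0]
        exact add_nonneg (mul_nonneg (corr_nonneg σ ht0 ht1 _ a b)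
          (sum_nonneg_mul_wt σ ht0 E hw)) hnn

/-- Cutting a set `Y` of vertices out of the system. -/
theorem corr_le_corr_inside_add (ht0 : 0 ≤ t) (ht1 : t ≤ 1)
    (hflip : ∀ u, ∃ g, σ u g = -1 ∧ ∀ v, v ≠ u → σ v g = 1) (E : Finset (Sym2 V))
    (Y : Finset V) {a : V} (ha : a ∉ Y) (b : V) :
    corr σ t E a b ≤ corr σ t (inside E {v | v ∉ Y}) a b
      + ∑ y ∈ Y, corr σ t E a y * corr σ t E y b := by
  have h := sum_mul_sgn_mul_wt_le σ ht0 ht1 {v | v ∉ Y} Y (const_mem_cone zero_le_one)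
    (fun u _ => (hflip u).imp fun g hg => ⟨hg.1, hg.2, fun _ => rfl⟩) b E
    (fun e _ v _ => (em (v ∈ Y)).symm) (a := a) ha
  simp only [one_mul, ← corr_mul_sum_wt σ ht0 ht1] at h
  simp only [← mul_assoc, ← Finset.sum_mul, ← add_mul] at h
  exact le_of_mul_le_mul_right h (sum_wt_pos σ ht0 ht1 E)

end Simon

/-! ### Joint exploration of two Ising models, one covering the other -/

section Exploration

open scoped Classical

variable {Ω : Type*} [CommGroup Ω] {X Z : Type*}

/-- `p` is a covering map of the graph with edge set `EZ` to the graph with edge set `EX`. -/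
structure IsCover (p : Z → X) (EX : Finset (Sym2 X)) (EZ : Finset (Sym2 Z)) : Prop where
  map_mem : ∀ e ∈ EZ, e.map p ∈ EX
  inj : ∀ k w w', s(k, w) ∈ EZ → s(k, w') ∈ EZ → p w = p w' → w = w'
  lift : ∀ k b, s(p k, b) ∈ EX → ∃ w, p w = b ∧ s(k, w) ∈ EZ

variable (Ω X Z) in
/-- A stage of the exploration: the explored vertices, the weight which has been revealed, and the
edges which have not been revealed. -/
structure Stage where
  K : Finset Z
  f : Ω → ℝ
  EX : Finset (Sym2 X)
  EZ : Finset (Sym2 Z)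

/-- The weight of the configurations at a stage of the exploration. -/
def Stage.weight (s : X → Ω →* ℤˣ) (σ : Z → Ω →* ℤˣ) (t : ℝ) (S : Stage Ω X Z) (ω : Ω) : ℝ :=
  S.f ω * (wt s t S.EX ω * wt σ t S.EZ ω)

/-- The invariants of the exploration from the vertex `o`. -/
structure Stage.Valid (s : X → Ω →* ℤˣ) (σ : Z → Ω →* ℤˣ) (p : Z → X) (EX : Finset (Sym2 X))
    (EZ : Finset (Sym2 Z)) (o : Z) (S : Stage Ω X Z) : Prop where
  f_mem : S.f ∈ cone Ω
  root_mem : o ∈ S.K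
  -- The relative sign of the two systems is constant on the explored set, wherever the revealed
  -- weight does not vanish.
  agree : ∀ k ∈ S.K, ∀ ω, S.f ω * sgn (s (p k) * σ k) ω = S.f ω * sgn (s (p o) * σ o) ω
  inv : ∀ g, (∀ k ∈ S.K, s (p k) g = 1 ∧ σ k g = 1) → ∀ ω, S.f (g * ω) = S.f ω
  subX : S.EX ⊆ EX
  subZ : S.EZ ⊆ EZ
  touch : ∀ e ∈ EZ, e ∉ S.EZ → ∃ k ∈ S.K, k ∈ e
  map_notMem : ∀ e ∈ EZ, e ∉ S.EZ → e.map p ∉ S.EX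
  -- A base edge is revealed together with one lift only. Its other lifts stay in `EZ` without
  -- partner, and through them the covering can deviate from the base.
  exists_of_map_notMem : ∀ e ∈ S.EZ, e.map p ∉ S.EX →
    ∃ e' ∈ EZ, e' ∉ S.EZ ∧ e'.map p = e.map p

/-- No edge can be explored any more. -/
def Stage.Terminal (p : Z → X) (S : Stage Ω X Z) : Prop :=
  ∀ e ∈ S.EZ, ∀ k ∈ S.K, k ∈ e → e.map p ∉ S.EX

/-- The explored fibres of which another vertex has been explored. -/
def Stage.doubled (p : Z → X) [Fintype Z] (S : Stage Ω X Z) : Finset Z :=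
  {y | ∃ k ∈ S.K, k ≠ y ∧ p k = p y}

variable {s : X → Ω →* ℤˣ} {σ : Z → Ω →* ℤˣ} {p : Z → X} {EX : Finset (Sym2 X)}
  {EZ : Finset (Sym2 Z)} {o : Z} {S : Stage Ω X Z}

/-- A base edge at `p k` lifts to an edge at `k`, which either could still be explored or has been
revealed and has used up its image. -/
theorem Stage.Valid.notMem_of_terminal (hp : IsCover p EX EZ) (hS : S.Valid s σ p EX EZ o)
    (hT : S.Terminal p) {k : Z} (hk : k ∈ S.K) : ∀ e ∈ S.EX, p k ∉ e := by
  rintro e he ⟨b, rfl⟩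
  obtain ⟨w, rfl, hw⟩ := hp.lift k b (hS.subX he)
  by_cases h : s(k, w) ∈ S.EZ
  · exact hT _ h k hk (Sym2.mem_mk_left k w) he
  · exact hS.map_notMem _ hw h he

/-- The base edge was used up by another lift, which has an explored end `l`. Unique lifting of
edges forces `l` to differ from the end of `s(k, w)` in its fibre, and so makes that end doubled. -/
theorem Stage.Valid.mem_doubled_of_terminal [Fintype Z] (hp : IsCover p EX EZ)
    (hS : S.Valid s σ p EX EZ o) (hT : S.Terminal p) {k w : Z} (hk : k ∈ S.K)
    (he : s(k, w) ∈ S.EZ) : k ∈ S.doubled p ∨ w ∈ S.doubled p := by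
  obtain ⟨e', he', hn', hm⟩ :=
    hS.exists_of_map_notMem _ he (hT _ he k hk (Sym2.mem_mk_left k w))
  obtain ⟨l, hl, v, rfl⟩ := hS.touch e' he' hn'
  have hne : s(l, v) ≠ s(k, w) := fun h => hn' (h ▸ he)
  simp only [Stage.doubled, Finset.mem_filter_univ]
  rw [Sym2.map_mk, Sym2.map_mk, Sym2.eq_iff] at hm
  rcases hm with ⟨h1, h2⟩ | ⟨h1, h2⟩
  · refine Or.inl ⟨l, hl, ?_, h1⟩
    rintro rfl
    rw [hp.inj l v w he' (hS.subZ he) h2] at hne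
    exact hne rfl
  · refine Or.inr ⟨l, hl, ?_, h1⟩
    rintro rfl
    rw [hp.inj l v k he' (by rw [Sym2.eq_swap]; exact hS.subZ he) h2] at hne
    exact hne Sym2.eq_swap

theorem Stage.valid_init (o : Z) (hp : IsCover p EX EZ) :
    (Stage.mk {o} 1 EX EZ : Stage Ω X Z).Valid s σ p EX EZ o where
  f_mem := one_mem _
  root_mem := Finset.mem_singleton_self o
  agree k hk ω := by rw [Finset.mem_singleton.1 hk]
  inv g _ ω := rfl
  subX := subset_rfl
  subZ := subset_rfl
  touch e he hn := absurd he hn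
  map_notMem e he hn := absurd he hn
  exists_of_map_notMem e he hn := absurd (hp.map_mem e he) hn

variable {t : ℝ}

/-- The edge from `k` to `w` is found closed. -/
theorem Stage.Valid.closed (ht0 : 0 ≤ t) (ht1 : t ≤ 1) (hS : S.Valid s σ p EX EZ o) {k w : Z}
    (hk : k ∈ S.K) (he : s(k, w) ∈ S.EZ) :
    (Stage.mk S.K (fun ω => S.f ω * (1 - t ^ 2)) (S.EX.erase s(p k, p w))
      (S.EZ.erase s(k, w))).Valid s σ p EX EZ o where
  f_mem := mul_mem hS.f_mem (const_mem_cone (by nlinarith))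
  root_mem := hS.root_mem
  agree k hk ω := by linear_combination (1 - t ^ 2) * hS.agree k hk ω
  inv g hg ω := by simp only [hS.inv g hg ω]
  subX := (Finset.erase_subset _ _).trans hS.subX
  subZ := (Finset.erase_subset _ _).trans hS.subZ
  touch e he' hn := by
    by_cases h : e = s(k, w)
    · exact ⟨k, hk, h ▸ Sym2.mem_mk_left k w⟩
    · exact hS.touch e he' fun h' => hn (Finset.mem_erase.2 ⟨h, h'⟩)
  map_notMem e he' hn := by
    by_cases h : e = s(k, w)
    · subst h; simp
    · exact fun h1 => hS.map_notMem e he' (fun h' => hn (Finset.mem_erase.2 ⟨h, h'⟩))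
        (Finset.mem_of_mem_erase h1)
  exists_of_map_notMem e he' hn := by
    by_cases h : e.map p = s(p k, p w)
    · exact ⟨s(k, w), hS.subZ he, Finset.notMem_erase _ _, h.symm⟩
    · obtain ⟨e1, h1, h2, h3⟩ := hS.exists_of_map_notMem e (Finset.mem_of_mem_erase he')
        fun h' => hn (Finset.mem_erase.2 ⟨h, h'⟩)
      exact ⟨e1, h1, fun h' => h2 (Finset.mem_of_mem_erase h'), h3⟩

/-- The edge from `k` to `w` is found open. -/
theorem Stage.Valid.open (ht0 : 0 ≤ t) (ht1 : t ≤ 1) (hS : S.Valid s σ p EX EZ o) {k w : Z}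
    (hk : k ∈ S.K) (he : s(k, w) ∈ S.EZ) :
    (Stage.mk (insert w S.K)
      (fun ω => S.f ω * (t * ((1 + sgn (s (p k) * s (p w) * (σ k * σ w)) ω)
        * (t + sgn (s (p k) * s (p w)) ω)))) (S.EX.erase s(p k, p w))
      (S.EZ.erase s(k, w))).Valid s σ p EX EZ o := by
  have hc := hS.closed ht0 ht1 hk he
  refine ⟨?_, Finset.mem_insert_of_mem hS.root_mem, ?_, ?_, hc.subX, hc.subZ, ?_, hc.map_notMem,
    hc.exists_of_map_notMem⟩
  · refine mul_mem hS.f_mem (mul_mem (const_mem_cone ht0) (mul_mem ?_ ?_))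
    · simpa using affine_mem_cone zero_le_one zero_le_one (s (p k) * s (p w) * (σ k * σ w))
    · simpa using affine_mem_cone ht0 zero_le_one (s (p k) * s (p w))
  · intro l hl ω
    rcases Finset.mem_insert.1 hl with rfl | hl
    · have h := hS.agree k hk ω
      have e1 := sgn_mul_self (s (p k)) ω
      have e2 := sgn_mul_self (s (p l)) ω
      have e3 := sgn_mul_self (σ k) ω
      have e4 := sgn_mul_self (σ l) ω
      simp only [sgn_mul] at h ⊢
      -- The factor `1 + sσ` vanishes unless the relative sign is the same at both ends of the edge.
      have key : (1 + sgn (s (p k)) ω * sgn (s (p l)) ω * (sgn (σ k) ω * sgn (σ l) ω))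
            * (sgn (s (p l)) ω * sgn (σ l) ω)
          = (1 + sgn (s (p k)) ω * sgn (s (p l)) ω * (sgn (σ k) ω * sgn (σ l) ω))
            * (sgn (s (p k)) ω * sgn (σ k) ω) := by
        rcases sgn_eq (s (p k)) ω with a1 | a1 <;> rcases sgn_eq (s (p l)) ω with a2 | a2 <;>
        rcases sgn_eq (σ k) ω with a3 | a3 <;> rcases sgn_eq (σ l) ω with a4 | a4 <;>
        rw [a1, a2, a3, a4] <;> norm_num
      linear_combination (S.f ω * t * (t + sgn (s (p k)) ω * sgn (s (p l)) ω)) * key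
        + t * (1 + sgn (s (p k)) ω * sgn (s (p l)) ω * (sgn (σ k) ω * sgn (σ l) ω))
          * (t + sgn (s (p k)) ω * sgn (s (p l)) ω) * h
    · linear_combination (t * ((1 + sgn (s (p k) * s (p w) * (σ k * σ w)) ω)
        * (t + sgn (s (p k) * s (p w)) ω))) * hS.agree l hl ω
  · intro g hg ω
    obtain ⟨h1, h2⟩ := hg k (Finset.mem_insert_of_mem hk)
    obtain ⟨h3, h4⟩ := hg w (Finset.mem_insert_self w S.K)
    have h5 : sgn (s (p k) * s (p w)) g = 1 := by simp [sgn, h1, h3]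
    have h6 : sgn (s (p k) * s (p w) * (σ k * σ w)) g = 1 := by simp [sgn, h1, h2, h3, h4]
    simp only [hS.inv g (fun l hl => hg l (Finset.mem_insert_of_mem hl)) ω,
      sgn_apply_mul _ g ω, h5, h6, one_mul]
  · intro e he' hn
    obtain ⟨l, hl, hle⟩ := hc.touch e he' hn
    exact ⟨l, Finset.mem_insert_of_mem hl, hle⟩

/-- The exploration ends: the weight is a sum of weights of terminal stages. -/
theorem Stage.Valid.exists_terminal (ht0 : 0 ≤ t) (ht1 : t ≤ 1) (hS : S.Valid s σ p EX EZ o) :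
    ∃ (ι : Type) (_ : Fintype ι) (l : ι → Stage Ω X Z),
      (∀ i, (l i).Valid s σ p EX EZ o ∧ (l i).Terminal p) ∧
      ∀ ω, S.weight s σ t ω = ∑ i, (l i).weight s σ t ω := by
  -- Both outcomes, closed and open, use up one base edge.
  induction hn : S.EX.card using Nat.strong_induction_on generalizing S with
  | _ n ih =>
    subst hn
    by_cases hT : S.Terminal p
    · exact ⟨Unit, inferInstance, fun _ => S, fun _ => ⟨hS, hT⟩, fun ω => by simp⟩
    · simp only [Stage.Terminal, not_forall, not_not] at hT
      obtain ⟨e, he, k, hk, ⟨w, rfl⟩, hm⟩ := hT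
      rw [Sym2.map_mk] at hm
      have hlt := Finset.card_erase_lt_of_mem hm
      obtain ⟨ι₁, _, l₁, hl₁, hw₁⟩ := ih _ hlt (hS.closed ht0 ht1 hk he) rfl
      obtain ⟨ι₂, _, l₂, hl₂, hw₂⟩ := ih _ hlt (hS.open ht0 ht1 hk he) rfl
      refine ⟨ι₁ ⊕ ι₂, inferInstance, Sum.elim l₁ l₂, ?_, fun ω => ?_⟩
      · rintro (i | i)
        · exact hl₁ i
        · exact hl₂ i
      · rw [Fintype.sum_sum_type]
        simp only [Sum.elim_inl, Sum.elim_inr]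
        rw [← hw₁ ω, ← hw₂ ω]
        -- The identity is `(1 + ts)(1 + tσ) = (1 - t²) + t(1 + sσ)(t + s)` for signs `s`, `σ`.
        simp only [Stage.weight]
        rw [wt_eq_mul_erase s t hm, wt_eq_mul_erase σ t he]
        simp only [edgeChar_mk]
        rw [sgn_mul (s (p k) * s (p w))]
        linear_combination (-S.f ω * wt s t (S.EX.erase s(p k, p w)) ω
          * wt σ t (S.EZ.erase s(k, w)) ω * t * sgn (σ k * σ w) ω) *
          sgn_mul_self (s (p k) * s (p w)) ω

end Exploration

/-! ### Comparison of the Ising models on a finite graph and on a finite covering -/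

section Covering

open scoped Classical

variable {X Z : Type*}

/-- The spin at a vertex. -/
def spin (x : X) : (X → ℤˣ) →* ℤˣ := Pi.evalMonoidHom (fun _ => ℤˣ) x

variable (Z) in
/-- A spin of the first of two systems. -/
def spinL (x : X) : (X → ℤˣ) × (Z → ℤˣ) →* ℤˣ := (spin x).comp (MonoidHom.fst _ _)

variable (X) in
/-- A spin of the second of two systems. -/
def spinR (z : Z) : (X → ℤˣ) × (Z → ℤˣ) →* ℤˣ := (spin z).comp (MonoidHom.snd _ _)

/-- The configuration which is `-1` on `A`. -/
def flip (A : Set X) : X → ℤˣ := fun x => if x ∈ A then -1 else 1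

theorem spin_flip_of_mem {A : Set X} {x : X} (h : x ∈ A) : spin x (flip A) = -1 := if_pos h

theorem spin_flip_of_notMem {A : Set X} {x : X} (h : x ∉ A) : spin x (flip A) = 1 := if_neg h

theorem sgn_edgeChar_spinL (e : Sym2 X) (ω : (X → ℤˣ) × (Z → ℤˣ)) :
    sgn (edgeChar (spinL Z) e) ω = sgn (edgeChar spin e) ω.1 := by
  induction e with
  | _ x y => rfl

theorem sgn_edgeChar_spinR (e : Sym2 Z) (ω : (X → ℤˣ) × (Z → ℤˣ)) :
    sgn (edgeChar (spinR X) e) ω = sgn (edgeChar spin e) ω.2 := by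
  induction e with
  | _ x y => rfl

variable {t : ℝ}

theorem wt_spinL (E : Finset (Sym2 X)) (ω : (X → ℤˣ) × (Z → ℤˣ)) :
    wt (spinL Z) t E ω = wt spin t E ω.1 := by
  simp only [wt, sgn_edgeChar_spinL]

theorem wt_spinR (E : Finset (Sym2 Z)) (ω : (X → ℤˣ) × (Z → ℤˣ)) :
    wt (spinR X) t E ω = wt spin t E ω.2 := by
  simp only [wt, sgn_edgeChar_spinR]

variable [Fintype X] [Fintype Z]

theorem corr_spinR (E : Finset (Sym2 Z)) (a b : Z) :
    corr (spinR X) t E a b = corr spin t E a b := by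
  have h1 : ∑ ω, sgn (spinR X a * spinR X b) ω * wt (spinR X) t E ω
      = (Fintype.card (X → ℤˣ) : ℝ) * ∑ ω, sgn (spin a * spin b) ω * wt spin t E ω := by
    rw [Fintype.sum_prod_type]
    simp only [wt_spinR]
    refine (Finset.sum_const (∑ ω, sgn (spin a * spin b) ω * wt spin t E ω)).trans ?_
    rw [nsmul_eq_mul]
    rfl
  have h2 : ∑ ω, wt (spinR X) t E ω = (Fintype.card (X → ℤˣ) : ℝ) * ∑ ω, wt spin t E ω := by
    rw [Fintype.sum_prod_type]
    simp only [wt_spinR]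
    refine (Finset.sum_const (∑ ω, wt spin t E ω)).trans ?_
    rw [nsmul_eq_mul]
    rfl
  rw [corr, h1, h2, corr, mul_div_mul_left]
  exact Nat.cast_ne_zero.2 Fintype.card_ne_zero

theorem sum_spinL_spinR (ht0 : 0 ≤ t) (ht1 : t ≤ 1) (EX : Finset (Sym2 X)) (EZ : Finset (Sym2 Z))
    (a b : X) (c d : Z) :
    ∑ ω, sgn (spinL Z a * spinL Z b * (spinR X c * spinR X d)) ω
        * (wt (spinL Z) t EX ω * wt (spinR X) t EZ ω)
      = corr spin t EX a b * corr spin t EZ c d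
        * ((∑ ω, wt spin t EX ω) * ∑ ω, wt spin t EZ ω) := by
  rw [mul_mul_mul_comm (corr spin t EX a b), corr_mul_sum_wt spin ht0 ht1,
    corr_mul_sum_wt spin ht0 ht1, Finset.sum_mul_sum, Fintype.sum_prod_type]
  refine Finset.sum_congr rfl fun ω _ => Finset.sum_congr rfl fun ρ _ => ?_
  rw [sgn_mul, wt_spinL, wt_spinR]
  have h1 : sgn (spinL Z a * spinL Z b) (ω, ρ) = sgn (spin a * spin b) ω := rfl
  have h2 : sgn (spinR X c * spinR X d) (ω, ρ) = sgn (spin c * spin d) ρ := rfl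
  rw [h1, h2]
  ring

variable (t) in
/-- The sum of a character for the weight at a stage of the exploration. -/
def Stage.sum (S : Stage ((X → ℤˣ) × (Z → ℤˣ)) X Z) (χ : (X → ℤˣ) × (Z → ℤˣ) →* ℤˣ) : ℝ :=
  ∑ ω, sgn χ ω * S.weight (spinL Z) (spinR X) t ω

variable {p : Z → X} {EX : Finset (Sym2 X)} {EZ : Finset (Sym2 Z)} {o : Z}
  {S : Stage ((X → ℤˣ) × (Z → ℤˣ)) X Z}

theorem Stage.Valid.sum_nonneg (ht0 : 0 ≤ t) (hS : S.Valid (spinL Z) (spinR X) p EX EZ o)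
    (χ : (X → ℤˣ) × (Z → ℤˣ) →* ℤˣ) : 0 ≤ S.sum t χ :=
  sum_nonneg_of_mem_cone (mul_mem (sgn_mem_cone χ) (mul_mem hS.f_mem
    (mul_mem (wt_mem_cone _ ht0 _) (wt_mem_cone _ ht0 _))))

theorem Stage.sum_congr {χ χ' : (X → ℤˣ) × (Z → ℤˣ) →* ℤˣ}
    (h : ∀ ω, S.f ω * sgn χ ω = S.f ω * sgn χ' ω) : S.sum t χ = S.sum t χ' := by
  refine Finset.sum_congr rfl fun ω _ => ?_
  simp only [Stage.weight]
  linear_combination (wt (spinL Z) t S.EX ω * wt (spinR X) t S.EZ ω) * h ω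

/-- The spins of the two systems agree along the explored set. -/
theorem Stage.Valid.sum_eq (hS : S.Valid (spinL Z) (spinR X) p EX EZ o) {k : Z} (hk : k ∈ S.K)
    (χ : (X → ℤˣ) × (Z → ℤˣ) →* ℤˣ) :
    S.sum t (spinL Z (p o) * spinL Z (p k) * χ) = S.sum t (spinR X o * spinR X k * χ) := by
  refine Stage.sum_congr fun ω => ?_
  have h := hS.agree k hk ω
  have e1 := sgn_mul_self (spinL Z (p o)) ω
  have e2 := sgn_mul_self (spinR X k) ω
  simp only [sgn_mul] at h ⊢
  linear_combination (sgn χ ω * sgn (spinL Z (p o)) ω * sgn (spinR X k) ω) * h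
    - (S.f ω * sgn χ ω * sgn (spinL Z (p o)) ω * sgn (spinL Z (p k)) ω) * e2
    + (S.f ω * sgn χ ω * sgn (spinR X o) ω * sgn (spinR X k) ω) * e1

/-- Flip all base spins outside the projection of `K`: the remaining base edges have both ends
there, and the revealed weight depends only on explored spins. Hence only the sign of the spin at
`x` changes. -/
theorem Stage.Valid.sum_eq_zero (hp : IsCover p EX EZ)
    (hS : S.Valid (spinL Z) (spinR X) p EX EZ o) (hT : S.Terminal p) {x : X}
    (hx : ∀ k ∈ S.K, p k ≠ x) : S.sum t (spinL Z (p o) * spinL Z x) = 0 := by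
  set A : Set X := {v | ∀ k ∈ S.K, p k ≠ v} with hA
  have hn : ∀ k ∈ S.K, p k ∉ A := fun k hk h => h k hk rfl
  have hL : ∀ v : X, spinL Z v (flip A, 1) = spin v (flip A) := fun v => rfl
  have hR : ∀ z : Z, spinR X z (flip A, 1) = 1 := fun z => rfl
  refine sum_sgn_mul_eq_zero (g := (flip A, 1)) ?_ fun ω => ?_
  · rw [MonoidHom.mul_apply, hL, hL, spin_flip_of_notMem (hn o hS.root_mem),
      spin_flip_of_mem (by exact hx), one_mul]
  · have h1 : wt (spinL Z) t S.EX ((flip A, 1) * ω) = wt (spinL Z) t S.EX ω := by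
      refine Finset.prod_congr rfl fun e he => ?_
      have hv : ∀ v ∈ e, v ∈ A := fun v hv k hk h =>
        hS.notMem_of_terminal hp hT hk e he (h ▸ hv)
      have : edgeChar (spinL Z) e (flip A, 1) = 1 := by
        induction e with
        | _ x y =>
          rw [edgeChar_mk, MonoidHom.mul_apply, hL, hL,
            spin_flip_of_mem (hv x (Sym2.mem_mk_left x y)),
            spin_flip_of_mem (hv y (Sym2.mem_mk_right x y))]
          rfl
      rw [sgn_apply_mul, sgn, this]
      simp
    have h2 : wt (spinR X) t S.EZ ((flip A, 1) * ω) = wt (spinR X) t S.EZ ω :=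
      wt_mul_of_fixed _ (fun e _ v _ => hR v) ω
    simp only [Stage.weight]
    rw [h1, h2, hS.inv]
    exact fun k hk => ⟨by rw [hL, spin_flip_of_notMem (hn k hk)], hR k⟩

/-- Screening: outside of the explored set, only the doubled vertices are correlated to the root. -/
theorem Stage.Valid.sum_le_doubled (ht0 : 0 ≤ t) (ht1 : t ≤ 1) (hp : IsCover p EX EZ)
    (hS : S.Valid (spinL Z) (spinR X) p EX EZ o) (hT : S.Terminal p) {a : Z}
    (ha : a ∈ S.K → a ∈ S.doubled p) :
    S.sum t (spinR X o * spinR X a)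
      ≤ ∑ y ∈ S.doubled p, corr spin t EZ a y * S.sum t (spinR X o * spinR X y) := by
  by_cases haD : a ∈ S.doubled p
  · have := Finset.single_le_sum (f := fun y => corr spin t EZ a y *
      S.sum t (spinR X o * spinR X y)) (fun y _ => mul_nonneg (corr_nonneg _ ht0 ht1 _ _ _)
        (hS.sum_nonneg ht0 _)) haD
    simpa [corr_self spin ht0 ht1] using this
  have haK : a ∉ S.K := fun h => haD (ha h)
  -- Simon's inequality is applied to the edges `EU` touching `U`, the vertices neither explored nor
  -- doubled; everything else goes into the weight `w`.
  set U : Set Z := {v | v ∉ S.K ∧ v ∉ S.doubled p} with hU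
  set EU := S.EZ.filter fun e => ∃ v ∈ e, v ∈ U with hEU
  set ER := S.EZ.filter fun e => ¬ ∃ v ∈ e, v ∈ U with hER
  have hL : ∀ u : Z, ∀ v : X, spinL Z v (1, flip {u}) = 1 := fun u v => rfl
  have hR : ∀ u z : Z, spinR X z (1, flip {u}) = spin z (flip {u}) := fun u z => rfl
  have hR1 : ∀ u z, z ≠ u → spinR X z (1, flip {u}) = 1 := fun u z h => by
    rw [hR, spin_flip_of_notMem (by simpa using h)]
  have hR2 : ∀ u, spinR X u (1, flip {u}) = -1 := fun u => by
    rw [hR, spin_flip_of_mem (by simp)]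
  have hwt : ∀ ω, wt (spinR X) t S.EZ ω = wt (spinR X) t ER ω * wt (spinR X) t EU ω := fun ω => by
    rw [mul_comm]
    exact (Finset.prod_filter_mul_prod_filter_not _ _ _).symm
  set w : (X → ℤˣ) × (Z → ℤˣ) → ℝ := S.f * (wt (spinL Z) t S.EX * wt (spinR X) t ER) with hw
  have hsum : ∀ c d, ∑ ω, w ω * sgn (spinR X c * spinR X d) ω * wt (spinR X) t EU ω
      = S.sum t (spinR X d * spinR X c) := fun c d => by
    rw [mul_comm (spinR X d)]
    refine Finset.sum_congr rfl fun ω _ => ?_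
    simp only [Stage.weight, hwt, hw, Pi.mul_apply]
    ring
  have h := sum_mul_sgn_mul_wt_le (spinR X) ht0 ht1 U (S.doubled p) (w := w)
    (mul_mem hS.f_mem (mul_mem (wt_mem_cone _ ht0 _) (wt_mem_cone _ ht0 _))) (fun u hu => by
      refine ⟨(1, flip {u}), hR2 u, fun v hv => hR1 u v hv, fun ω => ?_⟩
      simp only [hw, Pi.mul_apply]
      rw [hS.inv _ fun k hk => ⟨hL u _, hR1 u k fun h => hu.1 (h ▸ hk)⟩,
        wt_mul_of_fixed _ fun e _ v _ => hL u v, wt_mul_of_fixed _ fun e he v hv => hR1 u v ?_]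
      rintro rfl
      exact (Finset.mem_filter.1 he).2 ⟨v, hv, hu⟩) o EU (by
      rintro e he v ⟨u, rfl⟩
      obtain ⟨he1, c, hc, hcU⟩ := Finset.mem_filter.1 he
      rcases Sym2.mem_iff.1 hc with rfl | rfl
      · exact Or.inl hcU
      -- By `mem_doubled_of_terminal`, an edge from `U` can leave `U` only at a doubled vertex.
      · by_cases hvD : v ∈ S.doubled p
        · exact Or.inr hvD
        · refine Or.inl ⟨fun hvK => ?_, hvD⟩
          exact (hS.mem_doubled_of_terminal hp hT hvK he1).elim hvD hcU.2) (a := a) ⟨haK, haD⟩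
  -- The root is explored, so no edge inside `U` meets it.
  have h0 : corr (spinR X) t (inside EU U) a o = 0 := by
    refine corr_eq_zero (spinR X) (hR2 o) (hR1 o) (fun h => haK (h ▸ hS.root_mem)) ?_
    exact fun e he hoe => ((mem_inside.1 he).2 o hoe).1 hS.root_mem
  rw [h0, zero_mul, zero_add, hsum] at h
  refine h.trans (Finset.sum_le_sum fun y _ => ?_)
  rw [hsum, ← corr_spinR (X := X)]
  exact mul_le_mul_of_nonneg_right (corr_mono _ ht0 ht1
    ((Finset.filter_subset _ _).trans hS.subZ) _ _) (hS.sum_nonneg ht0 _)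

/-- If the exploration reaches the fibre of `x` at `k`, the base correlation is the covering
correlation of `k`; otherwise it is zero. -/
theorem Stage.Valid.sum_le_fiber (ht0 : 0 ≤ t) (hp : IsCover p EX EZ)
    (hS : S.Valid (spinL Z) (spinR X) p EX EZ o) (hT : S.Terminal p) (x : X) :
    S.sum t (spinL Z (p o) * spinL Z x) ≤ ∑ x' with p x' = x, S.sum t (spinR X o * spinR X x') := by
  by_cases h : ∃ k ∈ S.K, p k = x
  · obtain ⟨k, hk, rfl⟩ := h
    have h1 := hS.sum_eq (t := t) hk 1
    rw [mul_one, mul_one] at h1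
    rw [h1]
    exact Finset.single_le_sum (f := fun x' => S.sum t (spinR X o * spinR X x'))
      (fun _ _ => hS.sum_nonneg ht0 _) (by simp)
  · push Not at h
    rw [hS.sum_eq_zero hp hT h]
    exact Finset.sum_nonneg fun _ _ => hS.sum_nonneg ht0 _

/-- An explored `k` over `x` that is not doubled accounts for the base term and makes every other
point of the fibre doubled. Without such a `k`, screening applies to the whole fibre. -/
theorem Stage.Valid.sum_fiber_le (ht0 : 0 ≤ t) (ht1 : t ≤ 1) (hp : IsCover p EX EZ)
    (hS : S.Valid (spinL Z) (spinR X) p EX EZ o) (hT : S.Terminal p) (x : X) :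
    ∑ x' with p x' = x, S.sum t (spinR X o * spinR X x')
      ≤ S.sum t (spinL Z (p o) * spinL Z x) + ∑ x' with p x' = x,
        ∑ y ∈ S.doubled p, corr spin t EZ x' y * S.sum t (spinR X o * spinR X y) := by
  have hnn : ∀ x', 0 ≤ ∑ y ∈ S.doubled p, corr spin t EZ x' y * S.sum t (spinR X o * spinR X y) :=
    fun x' => Finset.sum_nonneg fun y _ => mul_nonneg (corr_nonneg _ ht0 ht1 _ _ _)
      (hS.sum_nonneg ht0 _)
  by_cases h : ∃ k ∈ S.K, p k = x ∧ k ∉ S.doubled p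
  · obtain ⟨k, hk, rfl, hkD⟩ := h
    have h1 := hS.sum_eq (t := t) hk 1
    rw [mul_one, mul_one] at h1
    have hmem : k ∈ Finset.univ.filter fun x' => p x' = p k := by simp
    rw [h1, ← Finset.add_sum_erase _ _ hmem]
    refine add_le_add le_rfl ((Finset.sum_le_sum fun x' hx' => ?_).trans
      (Finset.sum_le_sum_of_subset_of_nonneg (Finset.erase_subset k _) fun x' _ _ => hnn x'))
    refine hS.sum_le_doubled ht0 ht1 hp hT fun _ => ?_
    simp only [Finset.mem_erase, Finset.mem_filter_univ] at hx'
    simp only [Stage.doubled, Finset.mem_filter_univ]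
    exact ⟨k, hk, hx'.1.symm, hx'.2.symm⟩
  · push Not at h
    refine le_add_of_nonneg_of_le (hS.sum_nonneg ht0 _) (Finset.sum_le_sum fun x' hx' => ?_)
    exact hS.sum_le_doubled ht0 ht1 hp hT fun hk => h x' hk (by simpa using hx')

/-- Removing the explored set from the covering graph. -/
theorem Stage.Valid.corr_mul_sum_le (ht0 : 0 ≤ t) (ht1 : t ≤ 1)
    (hS : S.Valid (spinL Z) (spinR X) p EX EZ o) (χ : (X → ℤˣ) × (Z → ℤˣ) →* ℤˣ) (a b : Z) :
    corr spin t EZ a b * S.sum t χ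
      ≤ (if a ∈ S.K then 0 else S.sum t (χ * (spinR X a * spinR X b)))
        + ∑ z ∈ S.K, corr spin t EZ a z * corr spin t EZ z b * S.sum t χ := by
  split_ifs with h
  · have := Finset.single_le_sum (f := fun z => corr spin t EZ a z * corr spin t EZ z b * S.sum t χ)
      (fun z _ => mul_nonneg (mul_nonneg (corr_nonneg _ ht0 ht1 _ _ _)
        (corr_nonneg _ ht0 ht1 _ _ _)) (hS.sum_nonneg ht0 _)) h
    simpa [corr_self spin ht0 ht1] using this
  · have h1 := mul_le_mul_of_nonneg_right (corr_le_corr_inside_add spin ht0 ht1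
      (fun u => ⟨flip {u}, spin_flip_of_mem (by simp), fun v hv =>
        spin_flip_of_notMem (by simpa using hv)⟩) EZ S.K h b) (hS.sum_nonneg ht0 χ)
    rw [add_mul, Finset.sum_mul] at h1
    refine h1.trans (add_le_add ?_ le_rfl)
    rw [← corr_spinR (X := X)]
    -- A revealed edge has an explored end, so all edges avoiding `K` are still present with their
    -- full weight.
    have hsub : inside EZ {v | v ∉ S.K} ⊆ S.EZ := fun e he => by
      by_contra hn
      obtain ⟨k, hk, hke⟩ := hS.touch e (mem_inside.1 he).1 hn
      exact (mem_inside.1 he).2 k hke hk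
    have h2 := corr_mul_sum_le_of_subset (spinR X) ht0 ht1 hsub a b
      (F := S.f * wt (spinL Z) t S.EX * sgn χ)
      (mul_mem (mul_mem hS.f_mem (wt_mem_cone _ ht0 _)) (sgn_mem_cone _))
    refine (le_of_eq ?_).trans (h2.trans (le_of_eq ?_))
    · congr 1
      refine Finset.sum_congr rfl fun ω _ => ?_
      simp only [Stage.weight, Pi.mul_apply]
      ring
    · refine Finset.sum_congr rfl fun ω _ => ?_
      rw [sgn_mul χ]
      simp only [Stage.weight, Pi.mul_apply]
      ring

variable (t EX EZ) in
/-- The correlations of the base are bounded by those of the covering, with an error. -/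
theorem corr_covering (ht0 : 0 ≤ t) (ht1 : t ≤ 1) (hp : IsCover p EX EZ) (o : Z) (x : X) :
    corr spin t EX (p o) x ≤ ∑ x' with p x' = x, corr spin t EZ o x' ∧
    ∑ x' with p x' = x, corr spin t EZ o x' ≤ corr spin t EX (p o) x
      + ∑ x' with p x' = x, ∑ y, ∑ y' with y' ≠ y ∧ p y' = p y, ∑ z,
        corr spin t EZ o z * corr spin t EZ y z * corr spin t EZ y' z
          * corr spin t EX (p y') (p z) * corr spin t EZ x' y := by
  obtain ⟨ι, _, l, hl, hw⟩ := (Stage.valid_init (s := spinL Z) (σ := spinR X) o hp).exists_terminal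
    ht0 ht1
  set N := (∑ ω, wt spin t EX ω) * ∑ ω, wt spin t EZ ω with hN
  have hNpos : 0 < N := mul_pos (sum_wt_pos spin ht0 ht1 EX) (sum_wt_pos spin ht0 ht1 EZ)
  -- Summed over all terminal stages, the two independent systems are recovered and correlations
  -- factorise.
  have htot : ∀ a b c d, ∑ i, (l i).sum t (spinL Z a * spinL Z b * (spinR X c * spinR X d))
      = corr spin t EX a b * corr spin t EZ c d * N := fun a b c d => by
    rw [← sum_spinL_spinR ht0 ht1]
    simp only [Stage.sum]
    rw [Finset.sum_comm]
    refine Finset.sum_congr rfl fun ω _ => ?_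
    rw [← Finset.mul_sum, ← hw ω]
    simp [Stage.weight]
  have hLL : ∀ a : X, spinL Z a * spinL Z a = 1 := fun a => by
    ext ω; rw [MonoidHom.mul_apply, Int.units_mul_self]; rfl
  have hRR : ∀ a : Z, spinR X a * spinR X a = 1 := fun a => by
    ext ω; rw [MonoidHom.mul_apply, Int.units_mul_self]; rfl
  have htotL : ∀ a b, ∑ i, (l i).sum t (spinL Z a * spinL Z b) = corr spin t EX a b * N :=
    fun a b => by simpa [hRR, corr_self spin ht0 ht1] using htot a b o o
  have htotR : ∀ c d, ∑ i, (l i).sum t (spinR X c * spinR X d) = corr spin t EZ c d * N :=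
    fun c d => by simpa [hLL, corr_self spin ht0 ht1] using htot (p o) (p o) c d
  have htotF : ∑ i, ∑ x' with p x' = x, (l i).sum t (spinR X o * spinR X x')
      = (∑ x' with p x' = x, corr spin t EZ o x') * N := by
    rw [Finset.sum_comm, Finset.sum_mul]
    exact Finset.sum_congr rfl fun x' _ => htotR o x'
  constructor
  · refine le_of_mul_le_mul_right ?_ hNpos
    rw [← htotL, ← htotF]
    exact Finset.sum_le_sum fun i _ => (hl i).1.sum_le_fiber ht0 hp (hl i).2 x
  · -- the contribution of the explored pairs
    have hz : ∀ z v, ∑ i, (if z ∈ (l i).K then (l i).sum t (spinL Z (p o) * spinL Z v) else 0)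
        ≤ corr spin t EZ o z * corr spin t EX v (p z) * N := fun z v => by
      rw [corr_comm spin EX, mul_comm (corr spin t EZ o z), ← htot]
      refine Finset.sum_le_sum fun i _ => ?_
      split_ifs with h
      · have h1 := (hl i).1.sum_eq (t := t) h (spinL Z (p z) * spinL Z v)
        rw [show spinL Z (p o) * spinL Z (p z) * (spinL Z (p z) * spinL Z v)
          = spinL Z (p o) * (spinL Z (p z) * spinL Z (p z)) * spinL Z v by
            simp only [mul_assoc], hLL, mul_one, mul_comm (spinR X o * spinR X z)] at h1
        exact h1.le
      · exact (hl i).1.sum_nonneg ht0 _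
    -- When `y'` is explored, `σ_o σ_y` equals `s_{po} s_{py'} σ_{y'} σ_y`. The sum of the latter
    -- over all stages factorises; subtracting the stages where `y'` is unexplored and removing `K`
    -- with `corr_mul_sum_le` leaves a sum over explored `z`, bounded by `hz`.
    have hW : ∀ y y', p y' = p y →
        ∑ i, (if y' ∈ (l i).K then (l i).sum t (spinR X o * spinR X y) else 0)
          ≤ (∑ z, corr spin t EZ o z * corr spin t EZ y z * corr spin t EZ y' z
              * corr spin t EX (p y') (p z)) * N := fun y y' hy => by
      have h1 : ∀ i, (if y' ∈ (l i).K then (l i).sum t (spinR X o * spinR X y) else 0)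
          = (l i).sum t (spinL Z (p o) * spinL Z (p y') * (spinR X y' * spinR X y))
            - (if y' ∈ (l i).K then 0 else
              (l i).sum t (spinL Z (p o) * spinL Z (p y') * (spinR X y' * spinR X y))) := by
        intro i
        split_ifs with h
        · have h2 := (hl i).1.sum_eq (t := t) h (spinR X y' * spinR X y)
          rw [h2, sub_zero, show spinR X o * spinR X y' * (spinR X y' * spinR X y)
            = spinR X o * (spinR X y' * spinR X y') * spinR X y by simp only [mul_assoc],
            hRR, mul_one]
        · rw [sub_self]
      have h2 : ∑ i, (if y' ∈ (l i).K then (l i).sum t (spinR X o * spinR X y) else 0)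
          ≤ ∑ i, ∑ z ∈ (l i).K, corr spin t EZ y' z * corr spin t EZ z y
            * (l i).sum t (spinL Z (p o) * spinL Z (p y')) := by
        have h3 : ∑ i, (l i).sum t (spinL Z (p o) * spinL Z (p y') * (spinR X y' * spinR X y))
            = ∑ i, corr spin t EZ y' y * (l i).sum t (spinL Z (p o) * spinL Z (p y')) := by
          rw [htot, ← Finset.mul_sum, htotL]
          ring
        simp only [h1]
        rw [Finset.sum_sub_distrib, h3, ← Finset.sum_sub_distrib]
        refine Finset.sum_le_sum fun i _ => ?_
        rw [sub_le_iff_le_add']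
        exact (hl i).1.corr_mul_sum_le ht0 ht1 _ y' y
      refine h2.trans ?_
      have h4 : ∀ i, ∑ z ∈ (l i).K, corr spin t EZ y' z * corr spin t EZ z y
            * (l i).sum t (spinL Z (p o) * spinL Z (p y'))
          = ∑ z, corr spin t EZ y' z * corr spin t EZ z y
            * (if z ∈ (l i).K then (l i).sum t (spinL Z (p o) * spinL Z (p y')) else 0) := by
        intro i
        simp only [mul_ite, mul_zero]
        rw [← Finset.sum_filter]
        congr 1
        ext z
        simp
      simp only [h4]
      rw [Finset.sum_comm, Finset.sum_mul]
      refine Finset.sum_le_sum fun z _ => ?_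
      rw [← Finset.mul_sum]
      have h5 := mul_le_mul_of_nonneg_left (hz z (p y')) (mul_nonneg
        (corr_nonneg spin ht0 ht1 EZ y' z) (corr_nonneg spin ht0 ht1 EZ z y))
      refine h5.trans_eq ?_
      rw [corr_comm spin EZ z y]
      ring
    refine le_of_mul_le_mul_right ?_ hNpos
    rw [add_mul, ← htotL, ← htotF, Finset.sum_mul]
    refine (Finset.sum_le_sum fun i _ => (hl i).1.sum_fiber_le ht0 ht1 hp (hl i).2 x).trans ?_
    rw [Finset.sum_add_distrib]
    refine add_le_add le_rfl ?_
    rw [Finset.sum_comm]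
    refine Finset.sum_le_sum fun x' _ => ?_
    -- A doubled `y` is charged to an explored `y'` in its fibre.
    have h6 : ∀ i, ∑ y ∈ (l i).doubled p, corr spin t EZ x' y *
          (l i).sum t (spinR X o * spinR X y)
        ≤ ∑ y, ∑ y' with y' ≠ y ∧ p y' = p y, corr spin t EZ x' y *
          (if y' ∈ (l i).K then (l i).sum t (spinR X o * spinR X y) else 0) := fun i => by
      have hnn : ∀ y y', 0 ≤ corr spin t EZ x' y *
          (if y' ∈ (l i).K then (l i).sum t (spinR X o * spinR X y) else 0) := fun y y' =>
        mul_nonneg (corr_nonneg spin ht0 ht1 _ _ _) (by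
          split_ifs
          · exact (hl i).1.sum_nonneg ht0 _
          · exact le_rfl)
      refine (Finset.sum_le_sum fun y hy => ?_).trans (Finset.sum_le_sum_of_subset_of_nonneg
        (Finset.subset_univ _) fun y _ _ => Finset.sum_nonneg fun y' _ => hnn y y')
      simp only [Stage.doubled, Finset.mem_filter_univ] at hy
      obtain ⟨k, hk, hky, hpk⟩ := hy
      refine le_trans (le_of_eq ?_) (Finset.single_le_sum (fun y' _ => hnn y y')
        (show k ∈ Finset.univ.filter fun y' => y' ≠ y ∧ p y' = p y by simp [hky, hpk]))
      simp [hk]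
    refine (Finset.sum_le_sum fun i _ => h6 i).trans ?_
    rw [Finset.sum_comm, Finset.sum_mul]
    refine Finset.sum_le_sum fun y _ => ?_
    rw [Finset.sum_comm, Finset.sum_mul]
    refine Finset.sum_le_sum fun y' hy' => ?_
    rw [← Finset.mul_sum, ← Finset.sum_mul, mul_assoc, mul_left_comm]
    exact mul_le_mul_of_nonneg_left (hW y y' (by simpa using (Finset.mem_filter.1 hy').2.2))
      (corr_nonneg spin ht0 ht1 _ _ _)

end Covering

/-! ### The two-point function as a correlation -/

section Graph

open scoped Classical

variable {V V' : Type*} [Fintype V] [Fintype V'] {t : ℝ}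

/-- The set of edges of a finite graph. -/
def edges (G : SimpleGraph V) : Finset (Sym2 V) := G.edgeFinset

theorem mk_mem_edges {G : SimpleGraph V} {a b : V} : s(a, b) ∈ edges G ↔ G.Adj a b := by
  rw [edges, SimpleGraph.mem_edgeFinset, SimpleGraph.mem_edgeSet]

/-- High-temperature expansion: `exp (β s) = cosh β (1 + s tanh β)` for `s = ±1`. -/
theorem exp_hamiltonian (G : SimpleGraph V) (β : ℝ) (σ : V → ℤˣ) :
    Real.exp (-β * hamiltonian G σ)
      = Real.cosh β ^ (edges G).card * wt spin (Real.tanh β) (edges G) σ := by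
  have hspin : ∀ e : Sym2 V, edgeSpin σ e = sgn (edgeChar spin e) σ := by
    intro e
    induction e with
    | _ x y => simp [edgeSpin, sgn, spin]
  have hexp : ∀ e : Sym2 V, Real.exp (β * edgeSpin σ e)
      = Real.cosh β * (1 + Real.tanh β * sgn (edgeChar spin e) σ) := by
    intro e
    have hc : Real.cosh β ≠ 0 := (Real.cosh_pos β).ne'
    rw [hspin, Real.tanh_eq_sinh_div_cosh]
    rcases sgn_eq (edgeChar spin e) σ with h | h <;> rw [h] <;> field_simp
    · exact (Real.cosh_add_sinh β).symm
    · rw [← sub_eq_add_neg, Real.cosh_sub_sinh]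
  rw [hamiltonian, neg_mul_neg, Finset.mul_sum, Real.exp_sum, wt, ← Finset.prod_const,
    ← Finset.prod_mul_distrib]
  exact Finset.prod_congr rfl fun e _ => hexp e

theorem twoPoint_eq_corr (G : SimpleGraph V) (β : ℝ) (a b : V) :
    twoPoint G β a b = corr spin (Real.tanh β) (edges G) a b := by
  have hc : (Real.cosh β ^ (edges G).card) ≠ 0 := (pow_pos (Real.cosh_pos β) _).ne'
  have h1 : partitionFunction G β
      = Real.cosh β ^ (edges G).card * ∑ σ, wt spin (Real.tanh β) (edges G) σ := by
    simp only [partitionFunction, exp_hamiltonian, Finset.mul_sum]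
  have h2 : ∑ σ : V → ℤˣ, ((σ a : ℤ) : ℝ) * ((σ b : ℤ) : ℝ) * Real.exp (-β * hamiltonian G σ)
      = Real.cosh β ^ (edges G).card
        * ∑ σ, sgn (spin a * spin b) σ * wt spin (Real.tanh β) (edges G) σ := by
    rw [Finset.mul_sum]
    refine Finset.sum_congr rfl fun σ _ => ?_
    rw [exp_hamiltonian, sgn_mul]
    simp only [sgn, spin, Pi.evalMonoidHom_apply]
    ring
  rw [twoPoint, expectation, h1, h2, one_div_mul_eq_div, mul_div_mul_left _ _ hc, corr]

/-- Restriction along an injection is a surjective homomorphism, so it carries the uniform measure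
to the uniform measure. Translations lift through extension by `1`. -/
theorem sum_comp_injective {ι : V → V'} (hι : Function.Injective ι) (F : (V → ℤˣ) → ℝ) :
    (Fintype.card (V → ℤˣ) : ℝ) * ∑ ρ : V' → ℤˣ, F (ρ ∘ ι)
      = (Fintype.card (V' → ℤˣ) : ℝ) * ∑ ω, F ω := by
  have h1 : ∀ ω : V → ℤˣ, ∑ ρ : V' → ℤˣ, F (ρ ∘ ι) = ∑ ρ : V' → ℤˣ, F (ω * (ρ ∘ ι)) := by
    intro ω
    refine (Fintype.sum_equiv (Equiv.mulLeft (Function.extend ι ω 1)) _ _ fun ρ => ?_).symm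
    congr 1
    ext v
    simp [hι.extend_apply]
  have h2 : ∀ ρ : V' → ℤˣ, ∑ ω, F (ω * (ρ ∘ ι)) = ∑ ω, F ω := fun ρ =>
    Fintype.sum_equiv (Equiv.mulRight (ρ ∘ ι)) _ _ fun _ => rfl
  calc _ = ∑ ω : V → ℤˣ, ∑ ρ : V' → ℤˣ, F (ρ ∘ ι) := by
        rw [Finset.sum_const, nsmul_eq_mul]; rfl
    _ = ∑ ω : V → ℤˣ, ∑ ρ : V' → ℤˣ, F (ω * (ρ ∘ ι)) := Finset.sum_congr rfl fun ω _ => h1 ω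
    _ = ∑ ρ : V' → ℤˣ, ∑ ω, F (ω * (ρ ∘ ι)) := Finset.sum_comm
    _ = ∑ ρ : V' → ℤˣ, ∑ ω, F ω := Finset.sum_congr rfl fun ρ _ => h2 ρ
    _ = _ := by rw [Finset.sum_const, nsmul_eq_mul]; rfl

/-- Isolated vertices do not matter. -/
theorem corr_image {ι : V → V'} (hι : Function.Injective ι) (E : Finset (Sym2 V)) (a b : V) :
    corr spin t (E.image (Sym2.map ι)) (ι a) (ι b) = corr spin t E a b := by
  have hw : ∀ ρ : V' → ℤˣ, wt spin t (E.image (Sym2.map ι)) ρ = wt spin t E (ρ ∘ ι) := by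
    intro ρ
    rw [wt, Finset.prod_image fun _ _ _ _ h => Sym2.map.injective hι h]
    refine Finset.prod_congr rfl fun e _ => ?_
    induction e with
    | _ x y => rfl
  have h1 := sum_comp_injective hι fun ω => sgn (spin a * spin b) ω * wt spin t E ω
  have h2 := sum_comp_injective hι fun ω => wt spin t E ω
  have hs : ∀ ρ : V' → ℤˣ, sgn (spin (ι a) * spin (ι b)) ρ = sgn (spin a * spin b) (ρ ∘ ι) :=
    fun _ => rfl
  have hc : (Fintype.card (V → ℤˣ) : ℝ) ≠ 0 := Nat.cast_ne_zero.2 Fintype.card_ne_zero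
  have hc' : (Fintype.card (V' → ℤˣ) : ℝ) ≠ 0 := Nat.cast_ne_zero.2 Fintype.card_ne_zero
  simp only [corr, hw, hs]
  rw [← mul_div_mul_left _ _ hc, h1, h2, mul_div_mul_left _ _ hc']

theorem corr_le_of_map (ht0 : 0 ≤ t) (ht1 : t ≤ 1) {ι : V → V'} (hι : Function.Injective ι)
    {E : Finset (Sym2 V)} {E' : Finset (Sym2 V')} (h : ∀ e ∈ E, e.map ι ∈ E') (a b : V) :
    corr spin t E a b ≤ corr spin t E' (ι a) (ι b) := by
  rw [← corr_image hι]
  exact corr_mono _ ht0 ht1 (Finset.image_subset_iff.2 h) _ _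

theorem corr_le_of_subset_image (ht0 : 0 ≤ t) (ht1 : t ≤ 1) {ι : V → V'}
    (hι : Function.Injective ι) {E : Finset (Sym2 V)} {E' : Finset (Sym2 V')}
    (h : ∀ e ∈ E', ∃ e' ∈ E, e'.map ι = e) (a b : V) :
    corr spin t E' (ι a) (ι b) ≤ corr spin t E a b := by
  rw [← corr_image hι]
  exact corr_mono _ ht0 ht1 (fun e he => Finset.mem_image.2 (h e he)) _ _

/-- If `c` is the correlation without the edge, `corr_edge_mul` gives `(c + t) / (1 + t c)`, which
is at least `t`. -/
theorem le_corr_of_mem {V Ω : Type*} [CommGroup Ω] [Fintype Ω] (σ : V → Ω →* ℤˣ) (ht0 : 0 ≤ t)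
    (ht1 : t ≤ 1) {E : Finset (Sym2 V)} {a b : V} (h : s(a, b) ∈ E) : t ≤ corr σ t E a b := by
  have h1 := corr_edge_mul σ ht0 ht1 h b
  rw [corr_self σ ht0 ht1] at h1
  have h2 := corr_nonneg σ ht0 ht1 (E.erase s(a, b)) a b
  by_contra hlt
  have h3 : 0 < 1 + t * corr σ t (E.erase s(a, b)) a b := by positivity
  have h4 := mul_pos h3 (sub_pos.2 (not_le.1 hlt))
  have h5 : 0 ≤ corr σ t (E.erase s(a, b)) a b * (1 - t * t) := mul_nonneg h2 (by nlinarith)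
  linarith

variable {β : ℝ}

theorem tanh_pos (hβ : 0 < β) : 0 < Real.tanh β := by
  rw [Real.tanh_eq_sinh_div_cosh]
  exact div_pos (Real.sinh_pos_iff.2 hβ) (Real.cosh_pos β)

theorem tanh_nonneg (hβ : 0 < β) : 0 ≤ Real.tanh β := (tanh_pos hβ).le

theorem tanh_le_one (β : ℝ) : Real.tanh β ≤ 1 := (Real.tanh_lt_one β).le

theorem twoPoint_nonneg (hβ : 0 < β) (G : SimpleGraph V) (a b : V) : 0 ≤ twoPoint G β a b := by
  rw [twoPoint_eq_corr]
  exact corr_nonneg _ (tanh_nonneg hβ) (tanh_le_one β) _ _ _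

theorem twoPoint_le_one (hβ : 0 < β) (G : SimpleGraph V) (a b : V) : twoPoint G β a b ≤ 1 := by
  rw [twoPoint_eq_corr]
  exact corr_le_one _ (tanh_nonneg hβ) (tanh_le_one β) _ _ _

theorem twoPoint_self (hβ : 0 < β) (G : SimpleGraph V) (a : V) : twoPoint G β a a = 1 := by
  rw [twoPoint_eq_corr]
  exact corr_self _ (tanh_nonneg hβ) (tanh_le_one β) _ _

theorem twoPoint_comm (G : SimpleGraph V) (a b : V) : twoPoint G β a b = twoPoint G β b a := by
  rw [twoPoint_eq_corr, twoPoint_eq_corr, corr_comm]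

theorem twoPoint_mul_le (hβ : 0 < β) (G : SimpleGraph V) (a b c : V) :
    twoPoint G β a b * twoPoint G β b c ≤ twoPoint G β a c := by
  simp only [twoPoint_eq_corr]
  exact corr_mul_corr_le _ (tanh_nonneg hβ) (tanh_le_one β) _ _ _ _

theorem tanh_le_twoPoint (hβ : 0 < β) {G : SimpleGraph V} {a b : V} (h : G.Adj a b) :
    Real.tanh β ≤ twoPoint G β a b := by
  rw [twoPoint_eq_corr]
  exact le_corr_of_mem _ (tanh_nonneg hβ) (tanh_le_one β) (mk_mem_edges.2 h)

theorem twoPoint_le_of_hom (hβ : 0 < β) {G : SimpleGraph V} {G' : SimpleGraph V'} {ι : V → V'}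
    (hι : Function.Injective ι) (h : ∀ a b, G.Adj a b → G'.Adj (ι a) (ι b)) (a b : V) :
    twoPoint G β a b ≤ twoPoint G' β (ι a) (ι b) := by
  rw [twoPoint_eq_corr, twoPoint_eq_corr]
  refine corr_le_of_map (tanh_nonneg hβ) (tanh_le_one β) hι ?_ a b
  intro e he
  induction e with
  | _ x y => exact mk_mem_edges.2 (h x y (mk_mem_edges.1 he))

end Graph

/-! ### Nearest-neighbour graphs -/

section NearestNeighbour

variable {A B : Type*} [CommRing A] [CommRing B] {d : ℕ}

/-- The vectors `± e_i`. -/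
def IsUnitStep (s : Fin d → A) : Prop := ∃ i, s = Pi.single i 1 ∨ s = -Pi.single i 1

theorem IsUnitStep.map {s : Fin d → A} (h : IsUnitStep s) (f : A →+* B) : IsUnitStep (f ∘ s) := by
  have hs : ∀ i : Fin d, f ∘ (Pi.single i 1 : Fin d → A) = Pi.single i 1 := fun i => by
    ext j
    simp [Pi.single_apply, apply_ite f]
  obtain ⟨i, rfl | rfl⟩ := h
  · exact ⟨i, Or.inl (hs i)⟩
  · refine ⟨i, Or.inr ?_⟩
    rw [← hs i]
    ext j
    simp

theorem IsUnitStep.exists_map_eq {s : Fin d → B} (h : IsUnitStep s) (f : A →+* B) :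
    ∃ s' : Fin d → A, IsUnitStep s' ∧ f ∘ s' = s := by
  have hs : ∀ i : Fin d, f ∘ (Pi.single i 1 : Fin d → A) = Pi.single i 1 := fun i => by
    ext j
    simp [Pi.single_apply, apply_ite f]
  obtain ⟨i, rfl | rfl⟩ := h
  · exact ⟨_, ⟨i, Or.inl rfl⟩, hs i⟩
  · refine ⟨_, ⟨i, Or.inr rfl⟩, ?_⟩
    rw [← hs i]
    ext j
    simp

/-- The condition `1 ≠ -1` keeps `e_i` and `-e_i` apart in the quotient; on the torus it holds
because `r ≥ 3`. -/
theorem IsUnitStep.eq_of_map_eq {s s' : Fin d → A} (h : IsUnitStep s) (h' : IsUnitStep s')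
    (f : A →+* B) (h1 : (1 : B) ≠ 0) (h2 : (1 : B) ≠ -1) (he : f ∘ s = f ∘ s') : s = s' := by
  obtain ⟨i, hi⟩ := h
  obtain ⟨j, hj⟩ := h'
  have hij := congrFun he i
  by_cases hne : i = j
  · subst hne
    rcases hi with rfl | rfl <;> rcases hj with rfl | rfl <;> try rfl
    · simp only [Function.comp_apply, Pi.neg_apply, Pi.single_eq_same, map_neg, map_one] at hij
      exact absurd hij h2
    · simp only [Function.comp_apply, Pi.neg_apply, Pi.single_eq_same, map_neg, map_one] at hij
      exact absurd hij.symm h2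
  · rcases hi with rfl | rfl <;> rcases hj with rfl | rfl <;>
    simp [Pi.single_eq_of_ne hne, h1] at hij

theorem IsUnitStep.ne_zero [Nontrivial A] {s : Fin d → A} (h : IsUnitStep s) : s ≠ 0 := by
  obtain ⟨i, rfl | rfl⟩ := h <;> simp

theorem nnGraph_adj [Nontrivial A] {x y : Fin d → A} :
    (nnGraph A d).Adj x y ↔ IsUnitStep (y - x) := by
  rw [nnGraph, SimpleGraph.fromRel_adj]
  constructor
  · rintro ⟨_, ⟨i, h⟩ | ⟨i, h⟩⟩
    · exact ⟨i, Or.inl (by rw [h]; abel)⟩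
    · exact ⟨i, Or.inr (by rw [h]; abel)⟩
  · intro h
    refine ⟨fun he => h.ne_zero (by rw [he, sub_self]), ?_⟩
    obtain ⟨i, h | h⟩ := h
    · exact Or.inl ⟨i, by rw [← h]; abel⟩
    · refine Or.inr ⟨i, ?_⟩
      rw [← neg_eq_iff_eq_neg] at h
      rw [← h]; abel

/-- Edges at a vertex correspond to unit steps, and these lift uniquely. -/
theorem isCover_nnGraph [Fintype A] [Fintype B] [Nontrivial B] (f : A →+* B)
    (h2 : (1 : B) ≠ -1) :
    IsCover (fun x : Fin d → A => f ∘ x) (edges (nnGraph B d)) (edges (nnGraph A d)) := by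
  have : Nontrivial A := f.domain_nontrivial
  have hsub : ∀ x y : Fin d → A, f ∘ (y - x) = f ∘ y - f ∘ x := fun x y => by ext; simp
  refine ⟨fun e he => ?_, fun k w w' h h' hw => ?_, fun k b h => ?_⟩
  · induction e with
    | _ x y =>
      rw [mk_mem_edges, nnGraph_adj] at he
      rw [Sym2.map_mk, mk_mem_edges, nnGraph_adj, ← hsub]
      exact he.map f
  · rw [mk_mem_edges, nnGraph_adj] at h h'
    have := h.eq_of_map_eq h' f one_ne_zero h2 (by rw [hsub, hsub]; exact congrArg (· - _) hw)
    exact sub_left_injective this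
  · rw [mk_mem_edges, nnGraph_adj] at h
    obtain ⟨s, hs, hsb⟩ := h.exists_map_eq f
    refine ⟨k + s, ?_, ?_⟩
    · rw [eq_sub_iff_add_eq] at hsb
      rw [← hsb]
      ext i
      simp [add_comm]
    · rw [mk_mem_edges, nnGraph_adj]
      simpa using hs

theorem twoPoint_nnGraph_add [Fintype A] [Nontrivial A] {β : ℝ} (hβ : 0 < β) (a b c : Fin d → A) :
    twoPoint (nnGraph A d) β (c + a) (c + b) = twoPoint (nnGraph A d) β a b := by
  have h : ∀ a b c : Fin d → A, twoPoint (nnGraph A d) β a b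
      ≤ twoPoint (nnGraph A d) β (c + a) (c + b) := fun a b c =>
    twoPoint_le_of_hom hβ (add_right_injective c) (fun x y hxy => by
      rw [nnGraph_adj] at hxy ⊢
      simpa using hxy) a b
  refine le_antisymm ?_ (h a b c)
  simpa using h (c + a) (c + b) (-c)

theorem twoPoint_nnGraph_eq [Fintype A] [Nontrivial A] {β : ℝ} (hβ : 0 < β) (a b : Fin d → A) :
    twoPoint (nnGraph A d) β a b = twoPoint (nnGraph A d) β 0 (b - a) := by
  rw [← twoPoint_nnGraph_add hβ 0 (b - a) a]
  simp

theorem twoPoint_nnGraph_eq' [Fintype A] [Nontrivial A] {β : ℝ} (hβ : 0 < β) (a b : Fin d → A) :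
    twoPoint (nnGraph A d) β a b = twoPoint (nnGraph A d) β 0 (a - b) := by
  rw [twoPoint_comm, twoPoint_nnGraph_eq hβ]

open scoped Classical in
/-- Comparison of a torus and a larger torus which covers it. -/
theorem twoPoint_covering [Fintype A] [Fintype B] [Nontrivial B] (f : A →+* B) (h2 : (1 : B) ≠ -1)
    {β : ℝ} (hβ : 0 < β) (x : Fin d → B) :
    twoPoint (nnGraph B d) β 0 x ≤ ∑ x' : Fin d → A with f ∘ x' = x, twoPoint (nnGraph A d) β 0 x' ∧
    ∑ x' : Fin d → A with f ∘ x' = x, twoPoint (nnGraph A d) β 0 x'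
      ≤ twoPoint (nnGraph B d) β 0 x
        + ∑ x' : Fin d → A with f ∘ x' = x, ∑ y : Fin d → A,
          ∑ y' : Fin d → A with y' ≠ y ∧ f ∘ y' = f ∘ y, ∑ z : Fin d → A,
          twoPoint (nnGraph A d) β 0 z * twoPoint (nnGraph A d) β 0 (y - z)
            * twoPoint (nnGraph A d) β 0 (y' - z)
            * twoPoint (nnGraph B d) β 0 (f ∘ y' - f ∘ z)
            * twoPoint (nnGraph A d) β 0 (x' - y) := by
  have : Nontrivial A := f.domain_nontrivial
  have h := corr_covering (Real.tanh β) (edges (nnGraph B d)) (edges (nnGraph A d))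
    (tanh_nonneg hβ) (tanh_le_one β) (isCover_nnGraph (d := d) f h2) 0 x
  have h0 : f ∘ (0 : Fin d → A) = 0 := by ext; simp
  simp only [← twoPoint_eq_corr, h0] at h
  obtain ⟨gA, hgA⟩ : ∃ g : (Fin d → A) → ℝ, ∀ v, twoPoint (nnGraph A d) β 0 v = g v := ⟨_, fun _ => rfl⟩
  obtain ⟨gB, hgB⟩ : ∃ g : (Fin d → B) → ℝ, ∀ v, twoPoint (nnGraph B d) β 0 v = g v := ⟨_, fun _ => rfl⟩
  have hA : ∀ a b, twoPoint (nnGraph A d) β a b = gA (a - b) := fun a b => by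
    rw [twoPoint_nnGraph_eq' hβ, hgA]
  have hB : ∀ a b, twoPoint (nnGraph B d) β a b = gB (a - b) := fun a b => by
    rw [twoPoint_nnGraph_eq' hβ, hgB]
  have hA' : ∀ v, gA (-v) = gA v := fun v => by rw [← hgA v, hA, zero_sub]
  have hB' : ∀ v, gB (-v) = gB v := fun v => by rw [← hgB v, hB, zero_sub]
  simp only [hA, hB, zero_sub, hA', hB'] at h ⊢
  convert h

end NearestNeighbour

/-! ### Simon's inequality for a separating set -/

section SimonFinite

open scoped Classical

variable {V : Type*} [Fintype V] {t : ℝ}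

/-- The edges of `E` with an end point in `U`. -/
def touching (E : Finset (Sym2 V)) (U : Set V) : Finset (Sym2 V) := E.filter fun e => ∃ v ∈ e, v ∈ U

theorem mem_touching {E : Finset (Sym2 V)} {U : Set V} {e : Sym2 V} :
    e ∈ touching E U ↔ e ∈ E ∧ ∃ v ∈ e, v ∈ U := Finset.mem_filter

/-- Simon's inequality for a separating set `Y`. -/
theorem corr_le_of_separating (ht0 : 0 ≤ t) (ht1 : t ≤ 1) (E : Finset (Sym2 V)) (U : Set V)
    (Y : Finset V) (h : ∀ e ∈ touching E U, ∀ v ∈ e, v ∈ U ∨ v ∈ Y) {a : V} (ha : a ∈ U) (b : V) :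
    corr spin t E a b ≤ corr spin t (inside E U) a b
      + ∑ y ∈ Y, corr spin t (touching E U) a y * corr spin t E y b := by
  -- Edges not touching `U` form the weight `w`, which ignores the spins of `U`.
  set ER := E.filter fun e => ¬ ∃ v ∈ e, v ∈ U with hER
  have hwt : ∀ ω, wt spin t ER ω * wt spin t (touching E U) ω = wt spin t E ω := fun ω => by
    rw [mul_comm]
    exact Finset.prod_filter_mul_prod_filter_not _ _ _
  have hwt' : ∀ χ : (V → ℤˣ) →* ℤˣ, ∀ ω, wt spin t ER ω * sgn χ ω * wt spin t (touching E U) ω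
      = sgn χ ω * wt spin t E ω := fun χ ω => by
    rw [← hwt]
    ring
  have key := sum_mul_sgn_mul_wt_le spin ht0 ht1 U Y (wt_mem_cone spin ht0 ER) (fun u hu =>
    ⟨flip {u}, spin_flip_of_mem (by simp), fun v hv => spin_flip_of_notMem (by simpa using hv),
      fun ω => wt_mul_of_fixed spin (fun e he v hv => spin_flip_of_notMem fun hvu => by
        rw [Set.mem_singleton_iff] at hvu
        subst hvu
        exact (Finset.mem_filter.1 he).2 ⟨v, hv, hu⟩) ω⟩) b _ h ha
  simp only [hwt, hwt', ← corr_mul_sum_wt spin ht0 ht1 E] at key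
  simp only [← mul_assoc, ← Finset.sum_mul, ← add_mul] at key
  refine (le_of_mul_le_mul_right key (sum_wt_pos spin ht0 ht1 E)).trans (add_le_add ?_ le_rfl)
  refine corr_mono _ ht0 ht1 (fun e he => ?_) _ _
  rw [mem_inside] at he ⊢
  exact ⟨(Finset.mem_filter.1 he.1).1, he.2⟩

/-- Simon's inequality for a neighbourhood of a set `U` which embeds in another graph. -/
theorem twoPoint_le_of_embedded {V' : Type*} [Fintype V'] {β : ℝ} (hβ : 0 < β) (G : SimpleGraph V)
    (G' : SimpleGraph V') {ι : V' → V} (hι : Function.Injective ι) (U : Finset V')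
    (hadj : ∀ a ∈ U, ∀ w, G.Adj (ι a) w → ∃ a', ι a' = w ∧ G'.Adj a a') {o : V'} (ho : o ∈ U)
    (b : V) :
    twoPoint G β (ι o) b ≤ ∑ a with a ∈ U ∧ ι a = b, twoPoint G' β o a
      + ∑ y with y ∉ U, twoPoint G' β o y * twoPoint G β (ι y) b := by
  have ht0 := tanh_nonneg hβ
  have ht1 := tanh_le_one β
  set U' : Set V := ι '' U with hU
  have hedge : ∀ e ∈ touching (edges G) U', ∃ a ∈ U, ∃ a', G'.Adj a a' ∧ e = s(ι a, ι a') := by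
    intro e he
    obtain ⟨he, v, ⟨w, rfl⟩, a, ha, rfl⟩ := mem_touching.1 he
    obtain ⟨a', rfl, ha'⟩ := hadj a ha w (mk_mem_edges.1 he)
    exact ⟨a, ha, a', ha', rfl⟩
  have hoU : ι o ∈ U' := ⟨o, ho, rfl⟩
  -- The image of the complement of `U` separates: every edge at a point of `ι '' U` comes from
  -- `G'`.
  have h1 := corr_le_of_separating ht0 ht1 (edges G) U' ((Finset.univ.filter (· ∉ U)).image ι)
    (fun e he v hv => by
      obtain ⟨a, ha, a', ha', rfl⟩ := hedge e he
      rcases Sym2.mem_iff.1 hv with rfl | rfl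
      · exact Or.inl ⟨a, ha, rfl⟩
      · by_cases h : a' ∈ U
        · exact Or.inl ⟨_, h, rfl⟩
        · exact Or.inr (Finset.mem_image_of_mem _ (by simpa using h))) hoU b
  have hle : ∀ y, corr spin (Real.tanh β) (touching (edges G) U') (ι o) (ι y)
      ≤ twoPoint G' β o y := by
    intro y
    rw [twoPoint_eq_corr]
    refine corr_le_of_subset_image ht0 ht1 hι (fun e he => ?_) o y
    obtain ⟨a, ha, a', ha', rfl⟩ := hedge e he
    exact ⟨s(a, a'), mk_mem_edges.2 ha', rfl⟩
  rw [twoPoint_eq_corr]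
  refine h1.trans (add_le_add ?_ ?_)
  · by_cases hb : b ∈ U'
    · obtain ⟨a, ha, rfl⟩ := hb
      have hsub : inside (edges G) U' ⊆ touching (edges G) U' := fun e he => by
        rw [mem_inside] at he
        refine mem_touching.2 ⟨he.1, ?_⟩
        obtain ⟨he1, he2⟩ := he
        induction e with
        | _ x y => exact ⟨x, Sym2.mem_mk_left x y, he2 x (Sym2.mem_mk_left x y)⟩
      refine (corr_mono spin ht0 ht1 hsub _ _).trans ((hle a).trans ?_)
      exact Finset.single_le_sum (f := fun a => twoPoint G' β o a)
        (fun a _ => twoPoint_nonneg hβ G' o a) (Finset.mem_filter.2 ⟨Finset.mem_univ _, ha, rfl⟩)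
    · rw [corr_eq_zero spin (g := flip {b}) (spin_flip_of_mem (by simp))
        (fun v hv => spin_flip_of_notMem (by simpa using hv)) (fun h : ι o = b => hb (h ▸ hoU))
        fun e he hbe => hb ((mem_inside.1 he).2 b hbe)]
      exact Finset.sum_nonneg fun a _ => twoPoint_nonneg hβ _ _ _
  · rw [Finset.sum_image fun x _ y _ h => hι h]
    refine Finset.sum_le_sum fun y _ => ?_
    rw [← twoPoint_eq_corr]
    exact mul_le_mul_of_nonneg_right (hle y) (twoPoint_nonneg hβ _ _ _)

end SimonFinite

/-! ### The infinite-volume two-point function -/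

section InfiniteVolume

variable {d : ℕ} {β : ℝ}

theorem mem_box_of_lt {R : ℕ} {x : Fin d → ℤ} (h : ∀ i, 2 * |x i| < R) : x ∈ box d R := by
  rw [mem_box]
  intro i
  have h1 : (2 : ℝ) * |(x i : ℝ)| < R := by exact_mod_cast h i
  have h2 := neg_abs_le (x i : ℝ)
  have h3 := le_abs_self (x i : ℝ)
  constructor <;> linarith

theorem exists_mem_box (x : Fin d → ℤ) : ∃ R, x ∈ box d R := by
  refine ⟨2 * ∑ i, (x i).natAbs + 1, mem_box_of_lt fun i => ?_⟩
  have h : (x i).natAbs ≤ ∑ j, (x j).natAbs :=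
    Finset.single_le_sum (f := fun j => (x j).natAbs) (fun _ _ => Nat.zero_le _) (Finset.mem_univ i)
  have h2 : |x i| = ((x i).natAbs : ℤ) := Int.abs_eq_natAbs _
  rw [h2]
  exact_mod_cast (by omega : 2 * (x i).natAbs < 2 * ∑ j, (x j).natAbs + 1)

theorem box_mono {R R' : ℕ} (h : R ≤ R') : box d R ⊆ box d R' := by
  intro x hx
  rw [mem_box] at hx ⊢
  have h' : (R : ℝ) ≤ R' := by exact_mod_cast h
  intro i
  constructor <;> linarith [(hx i).1, (hx i).2]

theorem eventually_subset_box (F : Finset (Fin d → ℤ)) : ∀ᶠ R in atTop, F ⊆ box d R := by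
  choose f hf using exists_mem_box (d := d)
  filter_upwards [eventually_ge_atTop (F.sup f)] with R hR x hx
  exact box_mono ((Finset.le_sup hx).trans hR) (hf x)

theorem zero_mem_box {R : ℕ} (h : 1 ≤ R) : (0 : Fin d → ℤ) ∈ box d R :=
  mem_box_of_lt fun i => by simpa using Nat.lt_of_lt_of_le Nat.zero_lt_one h

/-- The half-side has to grow by `1`, hence `L + 2`. -/
theorem add_unitStep_mem_box {L : ℕ} {a s : Fin d → ℤ} (ha : a ∈ box d L) (hs : IsUnitStep s) :
    a + s ∈ box d (L + 2) := by
  have hb : ∀ i, -1 ≤ s i ∧ s i ≤ 1 := by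
    intro i
    obtain ⟨j, rfl | rfl⟩ := hs <;> by_cases h : i = j
    · subst h; simp
    · simp [h]
    · subst h; simp
    · simp [h]
  rw [mem_box] at ha ⊢
  intro i
  have h1 : (-1 : ℝ) ≤ (s i : ℝ) := by exact_mod_cast (hb i).1
  have h2 : (s i : ℝ) ≤ 1 := by exact_mod_cast (hb i).2
  have h3 := ha i
  push_cast [Pi.add_apply]
  constructor <;> linarith [h3.1, h3.2]

theorem boxTwoPoint_of_mem {R : ℕ} {x y : Fin d → ℤ} (hx : x ∈ box d R) (hy : y ∈ box d R) :
    boxTwoPoint d R β x y = twoPoint (boxGraph d R) β ⟨x, hx⟩ ⟨y, hy⟩ :=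
  dif_pos ⟨hx, hy⟩

theorem boxTwoPoint_of_notMem {R : ℕ} {x y : Fin d → ℤ} (h : ¬(x ∈ box d R ∧ y ∈ box d R)) :
    boxTwoPoint d R β x y = 0 := dif_neg h

theorem boxTwoPoint_nonneg (hβ : 0 < β) (R : ℕ) (x y : Fin d → ℤ) :
    0 ≤ boxTwoPoint d R β x y := by
  rw [boxTwoPoint]
  split_ifs
  · exact twoPoint_nonneg hβ _ _ _
  · exact le_rfl

theorem boxTwoPoint_le_one (hβ : 0 < β) (R : ℕ) (x y : Fin d → ℤ) :
    boxTwoPoint d R β x y ≤ 1 := by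
  rw [boxTwoPoint]
  split_ifs
  · exact twoPoint_le_one hβ _ _ _
  · exact zero_le_one

theorem boxGraph_adj {R : ℕ} {x y : box d R} :
    (boxGraph d R).Adj x y ↔ IsUnitStep (y.1 - x.1) := by
  rw [boxGraph, SimpleGraph.comap_adj, nnGraph_adj]

/-- This gives monotonicity in the volume (`c = 0`) and replaces translation invariance, which boxes
lack. -/
theorem boxTwoPoint_le_add (hβ : 0 < β) {R R' : ℕ} {c : Fin d → ℤ}
    (h : ∀ v ∈ box d R, v + c ∈ box d R') (a b : Fin d → ℤ) :
    boxTwoPoint d R β a b ≤ boxTwoPoint d R' β (a + c) (b + c) := by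
  by_cases hab : a ∈ box d R ∧ b ∈ box d R
  · rw [boxTwoPoint_of_mem hab.1 hab.2, boxTwoPoint_of_mem (h a hab.1) (h b hab.2)]
    refine twoPoint_le_of_hom (V := box d R) (V' := box d R') hβ
      (ι := fun v => ⟨v.1 + c, h v.1 v.2⟩) (fun v w hvw => ?_) (fun v w hvw => ?_) ⟨a, hab.1⟩ ⟨b, hab.2⟩
    · exact Subtype.ext (add_left_injective c (congrArg Subtype.val hvw))
    · rw [boxGraph_adj] at hvw ⊢
      simpa using hvw
  · rw [boxTwoPoint_of_notMem hab]
    exact boxTwoPoint_nonneg hβ _ _ _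

theorem boxTwoPoint_mono (hβ : 0 < β) (a b : Fin d → ℤ) :
    Monotone fun R => boxTwoPoint d R β a b := fun R R' h => by
  simpa using boxTwoPoint_le_add hβ (c := 0) (fun v hv => by simpa using box_mono h hv) a b

/-- Monotone in the volume and bounded by `1`; this is what makes `tau` a genuine limit. -/
theorem tendsto_boxTwoPoint (hβ : 0 < β) (x : Fin d → ℤ) :
    Tendsto (fun R => boxTwoPoint d R β 0 x) atTop (nhds (tau d β x)) := by
  refine tendsto_nhds_limUnder ⟨_, tendsto_atTop_ciSup (boxTwoPoint_mono hβ 0 x) ⟨1, ?_⟩⟩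
  rintro _ ⟨R, rfl⟩
  exact boxTwoPoint_le_one hβ R 0 x

theorem boxTwoPoint_le_tau (hβ : 0 < β) (R : ℕ) (x : Fin d → ℤ) :
    boxTwoPoint d R β 0 x ≤ tau d β x :=
  (boxTwoPoint_mono hβ 0 x).ge_of_tendsto (tendsto_boxTwoPoint hβ x) R

theorem tau_nonneg (hβ : 0 < β) (x : Fin d → ℤ) : 0 ≤ tau d β x :=
  (boxTwoPoint_nonneg hβ 0 0 x).trans (boxTwoPoint_le_tau hβ 0 x)

theorem tau_zero (hβ : 0 < β) : tau d β 0 = 1 := by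
  refine tendsto_nhds_unique (tendsto_boxTwoPoint hβ 0) ?_
  refine tendsto_const_nhds.congr' ?_
  filter_upwards [eventually_ge_atTop 1] with R hR
  rw [boxTwoPoint_of_mem (zero_mem_box hR) (zero_mem_box hR), twoPoint_self hβ]

theorem boxTwoPoint_mul_le (hβ : 0 < β) (R : ℕ) (a b c : Fin d → ℤ) :
    boxTwoPoint d R β a b * boxTwoPoint d R β b c ≤ boxTwoPoint d R β a c := by
  by_cases h : (a ∈ box d R ∧ b ∈ box d R) ∧ c ∈ box d R
  · rw [boxTwoPoint_of_mem h.1.1 h.1.2, boxTwoPoint_of_mem h.1.2 h.2,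
      boxTwoPoint_of_mem h.1.1 h.2]
    exact twoPoint_mul_le hβ _ _ _ _
  · have : boxTwoPoint d R β a b * boxTwoPoint d R β b c = 0 := by
      by_cases h1 : a ∈ box d R ∧ b ∈ box d R
      · rw [boxTwoPoint_of_notMem (x := b) fun h2 => h ⟨h1, h2.2⟩, mul_zero]
      · rw [boxTwoPoint_of_notMem h1, zero_mul]
    rw [this]
    exact boxTwoPoint_nonneg hβ _ _ _

/-- The box used for `b` is fixed and translated by `a` into a much larger box, where the
finite-volume inequality applies; the two limits are taken separately. -/
theorem tau_mul_le (hβ : 0 < β) (a b : Fin d → ℤ) :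
    tau d β a * tau d β b ≤ tau d β (a + b) := by
  refine le_of_tendsto ((tendsto_boxTwoPoint hβ b).const_mul (tau d β a)) (Eventually.of_forall
    fun R' => ?_)
  refine le_of_tendsto_of_tendsto ((tendsto_boxTwoPoint hβ a).mul_const _)
    (tendsto_boxTwoPoint hβ (a + b)) ?_
  filter_upwards [eventually_subset_box ((box d R').image (· + a))] with R hR
  refine le_trans ?_ (boxTwoPoint_mul_le hβ R 0 a (a + b))
  refine mul_le_mul_of_nonneg_left ?_ (boxTwoPoint_nonneg hβ _ _ _)
  have := boxTwoPoint_le_add hβ (c := a) (fun v hv => hR (Finset.mem_image_of_mem _ hv)) 0 b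
  rwa [zero_add, add_comm b] at this

/-- By `tau_mul_le` the points where `tau` is positive form a submonoid. It contains the unit steps,
since neighbours have correlation at least `tanh β`. -/
theorem tau_pos (hβ : 0 < β) (x : Fin d → ℤ) : 0 < tau d β x := by
  let S : AddSubmonoid (Fin d → ℤ) :=
    { carrier := {x | 0 < tau d β x}
      zero_mem' := by
        change 0 < tau d β 0
        rw [tau_zero hβ]
        exact one_pos
      add_mem' := fun {a b} ha hb => (mul_pos ha hb).trans_le (tau_mul_le hβ a b) }
  have hstep : ∀ s : Fin d → ℤ, IsUnitStep s → s ∈ S := by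
    intro s hs
    have h0 : (0 : Fin d → ℤ) ∈ box d 3 := zero_mem_box (by norm_num)
    have h1 : s ∈ box d 3 := by
      simpa using add_unitStep_mem_box (zero_mem_box le_rfl) hs
    refine ((tanh_pos hβ).trans_le ?_).trans_le (boxTwoPoint_le_tau hβ 3 s)
    rw [boxTwoPoint_of_mem h0 h1]
    exact tanh_le_twoPoint hβ (boxGraph_adj.2 (by simpa using hs))
  have hx : x ∈ S := by
    rw [← Finset.univ_sum_single x]
    refine sum_mem fun i _ => ?_
    have hsmul : ∀ c : ℤ, Pi.single i c = c • (Pi.single i 1 : Fin d → ℤ) := fun c => by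
      ext j
      simp [Pi.single_apply]
    obtain ⟨n, hn | hn⟩ := Int.eq_nat_or_neg (x i)
    · rw [hn, hsmul, natCast_zsmul]
      exact nsmul_mem (hstep _ ⟨i, Or.inl rfl⟩) n
    · rw [hn, hsmul, neg_smul, natCast_zsmul, ← smul_neg]
      exact nsmul_mem (hstep _ ⟨i, Or.inr rfl⟩) n
  exact hx

/-! ### The infinite-volume two-point function and large tori -/

theorem proj_injOn_box {M : ℕ} : Set.InjOn (proj d M) (box d M) := by
  intro x hx y hy h
  ext i
  have h1 := congrFun h i
  simp only [proj] at h1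
  rw [ZMod.intCast_eq_intCast_iff_dvd_sub] at h1
  have hx' := mem_box.1 hx i
  have hy' := mem_box.1 hy i
  have h2 : |y i - x i| < M := by
    have : |(y i : ℝ) - x i| < M := abs_lt.2 ⟨by linarith [hx'.2, hy'.1], by linarith [hx'.1, hy'.2]⟩
    exact_mod_cast this
  have := Int.eq_zero_of_abs_lt_dvd h1 h2
  linarith

theorem proj_sub (M : ℕ) (x y : Fin d → ℤ) : proj d M (x - y) = proj d M x - proj d M y := by
  ext i
  simp [proj]

theorem proj_add (M : ℕ) (x y : Fin d → ℤ) : proj d M (x + y) = proj d M x + proj d M y := by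
  ext i
  simp [proj]

theorem proj_zero (M : ℕ) : proj d M 0 = 0 := by
  ext i
  simp [proj]

theorem proj_eq_comp (M : ℕ) (x : Fin d → ℤ) : proj d M x = Int.castRingHom (ZMod M) ∘ x := rfl

/-- The torus is the box with additional wrap-around edges. -/
theorem boxTwoPoint_le_torusTau (hβ : 0 < β) {M : ℕ} [NeZero M] (hM : 2 ≤ M) (x : Fin d → ℤ) :
    boxTwoPoint d M β 0 x ≤ torusTau d M β (proj d M x) := by
  have : Fact (1 < M) := ⟨hM⟩
  by_cases h : 0 ∈ box d M ∧ x ∈ box d M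
  · rw [boxTwoPoint_of_mem h.1 h.2, torusTau, ← proj_zero M]
    refine twoPoint_le_of_hom (V := box d M) hβ (ι := fun v => proj d M v.1) (fun v w hvw => ?_)
      (fun v w hvw => ?_) ⟨0, h.1⟩ ⟨x, h.2⟩
    · exact Subtype.ext (proj_injOn_box v.2 w.2 hvw)
    · rw [boxGraph_adj] at hvw
      rw [nnGraph_adj, ← proj_sub]
      exact hvw.map (Int.castRingHom (ZMod M))
  · rw [boxTwoPoint_of_notMem h]
    exact twoPoint_nonneg hβ _ _ _

open scoped Classical in
/-- Simon's inequality on a torus, with the box `Λ_L` and its neighbourhood. -/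
theorem torusTau_le_add (hβ : 0 < β) {L M : ℕ} [NeZero M] (hL : 1 ≤ L) (hM : L + 2 ≤ M)
    (b : Fin d → ZMod M) :
    torusTau d M β b ≤ ∑ a ∈ box d L with proj d M a = b, tau d β a
      + ∑ y ∈ box d (L + 2) \ box d L, tau d β y * torusTau d M β (b - proj d M y) := by
  have : Fact (1 < M) := ⟨by omega⟩
  have hLL : box d L ⊆ box d (L + 2) := box_mono (by omega)
  -- Since `L + 2 ≤ M`, the neighbourhood `Λ_{L+2}` of `Λ_L` does not wrap around the torus.
  have hinj : Set.InjOn (proj d M) (box d (L + 2)) :=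
    proj_injOn_box.mono (Finset.coe_subset.2 (box_mono hM))
  have h0 : (0 : Fin d → ℤ) ∈ box d (L + 2) := hLL (zero_mem_box hL)
  have h := twoPoint_le_of_embedded hβ (nnGraph (ZMod M) d) (boxGraph d (L + 2))
    (ι := fun v => proj d M v.1) (fun v w hvw => Subtype.ext (hinj v.2 w.2 hvw))
    (Finset.univ.filter fun v => v.1 ∈ box d L) (fun a ha w haw => by
      rw [nnGraph_adj] at haw
      obtain ⟨s, hs, hsw⟩ := haw.exists_map_eq (Int.castRingHom (ZMod M))
      refine ⟨⟨a.1 + s, add_unitStep_mem_box (by simpa using ha) hs⟩, ?_, ?_⟩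
      · rw [proj_add, proj_eq_comp M s, hsw]
        abel
      · rw [boxGraph_adj]
        simpa using hs) (o := ⟨0, h0⟩) (by simpa using zero_mem_box hL) b
  have htau : ∀ y : box d (L + 2), twoPoint (boxGraph d (L + 2)) β ⟨0, h0⟩ y ≤ tau d β y.1 :=
    fun y => by
      rw [← boxTwoPoint_of_mem h0 y.2]
      exact boxTwoPoint_le_tau hβ (L + 2) y.1
  simp only [proj_zero, Finset.mem_filter_univ] at h
  refine h.trans (add_le_add ?_ ?_)
  · refine (Finset.sum_le_sum fun a _ => htau a).trans_eq ?_
    rw [Finset.sum_filter, Finset.sum_coe_sort (box d (L + 2))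
      (fun a => if a ∈ box d L ∧ proj d M a = b then tau d β a else 0), ← Finset.sum_filter]
    congr 1
    ext a
    simp only [Finset.mem_filter]
    exact ⟨fun h => h.2, fun h => ⟨hLL h.1, h⟩⟩
  · have hmul : ∀ y : box d (L + 2), twoPoint (boxGraph d (L + 2)) β ⟨0, h0⟩ y
        * twoPoint (nnGraph (ZMod M) d) β (proj d M y.1) b
        ≤ tau d β y.1 * torusTau d M β (b - proj d M y.1) := fun y => by
      rw [twoPoint_nnGraph_eq hβ, torusTau]
      exact mul_le_mul_of_nonneg_right (htau y) (twoPoint_nonneg hβ _ _ _)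
    refine (Finset.sum_le_sum fun y _ => hmul y).trans_eq ?_
    rw [Finset.sum_filter, Finset.sum_coe_sort (box d (L + 2)) (fun y => if y ∉ box d L then
      tau d β y * torusTau d M β (b - proj d M y) else 0), ← Finset.sum_filter,
      Finset.filter_notMem_eq_sdiff]

end InfiniteVolume

/-! ### Rearrangement of the error term -/

section Rearrangement

open scoped Classical

variable {A B C : Type*} [AddCommGroup A] [AddCommGroup B] [AddCommGroup C]

/-- The sum of `f a * f b` over the pairs `(a, b)` which satisfy `R`. -/
def pairSum {A : Type*} (f : A → ℝ≥0∞) (R : A → A → Prop) : ℝ≥0∞ :=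
  ∑' a, ∑' b, if R a b then f a * f b else 0

/-- The error term of the comparison of two-point functions. -/
def errorSum (p : A →+ C) (f : A → ℝ≥0∞) (g : C → ℝ≥0∞) (x : C) : ℝ≥0∞ :=
  ∑' x', ∑' y, ∑' y', ∑' z, if p x' = x ∧ (p y' = p y ∧ y' ≠ y) then
    f z * f (y - z) * f (y' - z) * g (p y' - p z) * f (x' - y) else 0

theorem tsum_prod_four {A : Type*} (G : A → A → A → A → ℝ≥0∞) :
    ∑' q : A × A × A × A, G q.1 q.2.1 q.2.2.1 q.2.2.2 = ∑' a, ∑' b, ∑' c, ∑' e, G a b c e := by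
  simp only [ENNReal.tsum_prod']

/-- With `v = p (y' - z)` fixed, the remaining sums decouple into two pair sums of `f`. These behave
well under push-forward and small perturbations, and `v` ranges over a finite group in the
application. -/
theorem errorSum_eq (p : A →+ C) (f : A → ℝ≥0∞) (g : C → ℝ≥0∞) (x : C) :
    errorSum p f g x = ∑' v, g v * (pairSum f (fun a b => p a = v ∧ p b = v ∧ b ≠ a)
      * pairSum f fun a b => p a + p b = x - v) := by
  -- The new variables are `a = y - z`, `b = y' - z`, `z` and `c = x' - y`.
  let e : A × A × A × A ≃ A × A × A × A :=
    { toFun := fun q => (q.2.2.1 + q.1 + q.2.2.2, q.2.2.1 + q.1, q.2.2.1 + q.2.1, q.2.2.1)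
      invFun := fun q => (q.2.1 - q.2.2.2, q.2.2.1 - q.2.2.2, q.2.2.2, q.1 - q.2.1)
      left_inv := fun ⟨a, b, z, c⟩ => by simp
      right_inv := fun ⟨a, b, z, c⟩ => by simp }
  have hR : ∀ v, g v * (pairSum f (fun a b => p a = v ∧ p b = v ∧ b ≠ a)
      * pairSum f fun a b => p a + p b = x - v)
      = ∑' q : A × A × A × A, g v * ((if p q.1 = v ∧ p q.2.1 = v ∧ q.2.1 ≠ q.1 then
          f q.1 * f q.2.1 else 0) *
          (if p q.2.2.1 + p q.2.2.2 = x - v then f q.2.2.1 * f q.2.2.2 else 0)) := by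
    intro v
    rw [tsum_prod_four fun a b z c => g v * ((if p a = v ∧ p b = v ∧ b ≠ a then
          f a * f b else 0) * (if p z + p c = x - v then f z * f c else 0))]
    simp only [ENNReal.tsum_mul_left, ENNReal.tsum_mul_right, pairSum]
    congr!
  simp only [hR]
  rw [ENNReal.tsum_comm, errorSum, ← tsum_prod_four fun x' y y' z =>
    if p x' = x ∧ (p y' = p y ∧ y' ≠ y) then
      f z * f (y - z) * f (y' - z) * g (p y' - p z) * f (x' - y) else 0, ← e.tsum_eq]
  refine tsum_congr fun q => ?_
  obtain ⟨a, b, z, c⟩ := q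
  rw [tsum_eq_single (p a) fun v hv => by
    rw [if_neg fun h => hv h.1.symm, zero_mul, mul_zero]]
  have h1 : (p z + p c = x - p a) ↔ (p z + p a + p c = x) := by
    rw [eq_sub_iff_add_eq, add_right_comm]
  simp only [e, Equiv.coe_fn_mk, map_add, add_sub_cancel_left, add_right_inj, ne_eq, true_and, h1]
  by_cases h2 : p b = p a ∧ b ≠ a
  · by_cases h3 : p z + p a + p c = x
    · simp only [h2, h3, true_and, not_false_eq_true, if_true]
      ring
    · simp [h3]
  · simp [h2]

/-- Push-forward of a weight. -/
def pushforward {A B : Type*} (q : A → B) (f : A → ℝ≥0∞) (b : B) : ℝ≥0∞ :=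
  ∑' a, if q a = b then f a else 0

theorem tsum_mul_pushforward {A B : Type*} (q : A → B) (f : A → ℝ≥0∞) (F : B → ℝ≥0∞) :
    ∑' b, F b * pushforward q f b = ∑' a, F (q a) * f a := by
  simp only [pushforward, ← ENNReal.tsum_mul_left]
  rw [ENNReal.tsum_comm]
  refine tsum_congr fun a => ?_
  rw [tsum_eq_single (q a) fun b hb => by rw [if_neg fun h => hb h.symm, mul_zero], if_pos rfl]

theorem tsum_pushforward {A B : Type*} (q : A → B) (f : A → ℝ≥0∞) :
    ∑' b, pushforward q f b = ∑' a, f a := by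
  simpa using tsum_mul_pushforward q f fun _ => 1

theorem pushforward_comp {A B C : Type*} (q : A → B) (p : B → C) (f : A → ℝ≥0∞) (c : C) :
    pushforward p (pushforward q f) c = pushforward (p ∘ q) f c := by
  have := tsum_mul_pushforward q f fun b => if p b = c then 1 else 0
  simp only [ite_mul, one_mul, zero_mul] at this
  exact this

theorem pairSum_pushforward {A B : Type*} (q : A → B) (f : A → ℝ≥0∞) (R : B → B → Prop) :
    pairSum (pushforward q f) R = pairSum f fun a a' => R (q a) (q a') := by
  have h : ∀ b, (∑' b', if R b b' then pushforward q f b * pushforward q f b' else 0)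
      = (∑' a', if R b (q a') then f a' else 0) * pushforward q f b := by
    intro b
    have := tsum_mul_pushforward q f fun b' => if R b b' then 1 else 0
    simp only [ite_mul, one_mul, zero_mul] at this
    rw [← this, ← ENNReal.tsum_mul_right]
    refine tsum_congr fun b' => ?_
    split_ifs
    · rw [mul_comm]
    · rw [zero_mul]
  simp only [pairSum, h]
  rw [tsum_mul_pushforward q f fun b => ∑' a', if R b (q a') then f a' else 0]
  refine tsum_congr fun a => ?_
  rw [← ENNReal.tsum_mul_right]
  refine tsum_congr fun a' => ?_
  split_ifs
  · rw [mul_comm]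
  · rw [zero_mul]

theorem pairSum_mono {A : Type*} {f f' : A → ℝ≥0∞} {R R' : A → A → Prop} (hf : ∀ a, f a ≤ f' a)
    (hR : ∀ a b, R a b → R' a b) : pairSum f R ≤ pairSum f' R' := by
  refine ENNReal.tsum_le_tsum fun a => ENNReal.tsum_le_tsum fun b => ?_
  by_cases h : R a b
  · rw [if_pos h, if_pos (hR a b h)]
    exact mul_le_mul' (hf a) (hf b)
  · rw [if_neg h]
    exact zero_le

theorem pairSum_le {A : Type*} (f : A → ℝ≥0∞) (R : A → A → Prop) :
    pairSum f R ≤ (∑' a, f a) * ∑' a, f a := by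
  rw [← ENNReal.tsum_mul_right]
  refine ENNReal.tsum_le_tsum fun a => ?_
  rw [← ENNReal.tsum_mul_left]
  refine ENNReal.tsum_le_tsum fun b => ?_
  split_ifs
  · exact le_rfl
  · exact zero_le

theorem pairSum_add_le {A : Type*} (f h : A → ℝ≥0∞) (R : A → A → Prop) :
    pairSum (fun a => f a + h a) R
      ≤ pairSum f R + (∑' a, h a) * (2 * (∑' a, f a) + ∑' a, h a) := by
  have h1 : (∑' a, h a) * (2 * (∑' a, f a) + ∑' a, h a)
      = ∑' a, ∑' b, (f a * h b + h a * f b + h a * h b) := by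
    simp only [ENNReal.tsum_add, ENNReal.tsum_mul_left, ENNReal.tsum_mul_right]
    ring
  rw [h1, pairSum, pairSum, ← ENNReal.tsum_add]
  refine ENNReal.tsum_le_tsum fun a => ?_
  rw [← ENNReal.tsum_add]
  refine ENNReal.tsum_le_tsum fun b => ?_
  split_ifs
  · exact le_of_eq (by ring)
  · exact zero_le

/-- Comparison of the error terms of a covering and of its quotient. -/
theorem errorSum_le_of_le_pushforward (q : A →+ B) (p : B →+ C) (f : A → ℝ≥0∞) (h ρ : B → ℝ≥0∞)
    (hh : ∀ b, h b ≤ pushforward q f b + ρ b) (g : C → ℝ≥0∞) (x : C) {δ : ℝ≥0∞}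
    (hδ : (∑' b, ρ b) * (2 * (∑' a, f a) + ∑' b, ρ b) ≤ δ) :
    errorSum p h g x ≤ ∑' v, g v *
      ((pairSum f (fun a b => p (q a) = v ∧ p (q b) = v ∧ b ≠ a) + δ)
        * (pairSum f (fun a b => p (q a) + p (q b) = x - v) + δ)) := by
  have key : ∀ R : B → B → Prop, pairSum h R ≤ pairSum f (fun a b => R (q a) (q b)) + δ := by
    intro R
    refine (pairSum_mono hh fun _ _ h => h).trans ((pairSum_add_le _ _ R).trans ?_)
    rw [pairSum_pushforward, tsum_pushforward]
    exact add_le_add le_rfl hδ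
  rw [errorSum_eq]
  refine ENNReal.tsum_le_tsum fun v => mul_le_mul' le_rfl (mul_le_mul' ?_ (key _))
  refine (key _).trans (add_le_add (pairSum_mono (fun _ => le_rfl) ?_) le_rfl)
  -- Distinct images have distinct preimages, so the condition on the pair only weakens.
  exact fun a b ⟨h1, h2, h3⟩ => ⟨h1, h2, fun h => h3 (by rw [h])⟩

end Rearrangement

/-! ### Passage to the limit of large covering tori -/

section Limit

open scoped Classical

variable {d : ℕ} {β : ℝ}

theorem sum_ite_le_tsum {A : Type*} (s : Finset A) (f : A → ℝ≥0∞) (P : A → Prop) :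
    ∑ a ∈ s with P a, f a ≤ ∑' a, if P a then f a else 0 := by
  rw [Finset.sum_filter]
  exact ENNReal.sum_le_tsum s

theorem tsum_subtype_eq_ite {A : Type*} (P : A → Prop) (f : A → ℝ≥0∞) :
    ∑' a : {a // P a}, f a = ∑' a, if P a then f a else 0 := by
  have := tsum_subtype {a | P a} f
  exact this

/-- A torus two-point function is close to the sum of the infinite-volume one over the fibres. -/
theorem exists_torusTau_le_pushforward (hβ : 0 < β)
    (hχ : ∑' x : Fin d → ℤ, ENNReal.ofReal (tau d β x) ≠ ∞) {ε : ℝ≥0∞} (hε : ε ≠ 0) :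
    ∃ M₀ : ℕ, ∀ (M : ℕ) [NeZero M], M₀ ≤ M → ∃ ρ : (Fin d → ZMod M) → ℝ≥0∞, ∑' b, ρ b ≤ ε ∧
      ∀ b, ENNReal.ofReal (torusTau d M β b)
        ≤ pushforward (proj d M) (fun x => ENNReal.ofReal (tau d β x)) b + ρ b := by
  set f : (Fin d → ℤ) → ℝ≥0∞ := fun x => ENNReal.ofReal (tau d β x) with hf
  set χ := ∑' x, f x with hχdef
  have hχ1 : 2 * χ + 1 ≠ ∞ :=
    ENNReal.add_ne_top.2 ⟨ENNReal.mul_ne_top ENNReal.ofNat_ne_top hχ, ENNReal.one_ne_top⟩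
  -- The bound `1/2` on the boundary mass `φ` lets `H ≤ χ + φ H` be absorbed into `H ≤ 2χ`; the
  -- other bound then gives `φ H ≤ ε`.
  have hη : 0 < min 2⁻¹ (ε / (2 * χ + 1)) :=
    lt_min (ENNReal.inv_pos.2 ENNReal.ofNat_ne_top) (ENNReal.div_pos hε hχ1)
  have htail := (ENNReal.tendsto_tsum_compl_atTop_zero hχ).eventually_lt_const hη
  obtain ⟨s, hs⟩ := eventually_atTop.1 htail
  obtain ⟨L, hsL, hL⟩ := ((eventually_subset_box s).and (eventually_ge_atTop 1)).exists
  refine ⟨L + 2, fun M _ hM => ?_⟩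
  set S := box d (L + 2) \ box d L with hS
  set φ := ∑ y ∈ S, f y with hφdef
  have hφ : φ ≤ min 2⁻¹ (ε / (2 * χ + 1)) := by
    refine le_trans ?_ (hs _ hsL).le
    rw [tsum_subtype_eq_ite (fun x => x ∉ box d L) f]
    refine le_trans (le_of_eq ?_) (ENNReal.sum_le_tsum S)
    exact Finset.sum_congr rfl fun x hx => (if_pos (Finset.mem_sdiff.1 hx).2).symm
  set h : (Fin d → ZMod M) → ℝ≥0∞ := fun b => ENNReal.ofReal (torusTau d M β b) with hh
  set H := ∑' b, h b with hHdef
  -- Finiteness of the total mass `H` allows `H / 2` to be cancelled below.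
  have hH : H ≠ ∞ := by
    rw [hHdef, tsum_fintype]
    exact ENNReal.sum_ne_top.2 fun b _ => ENNReal.ofReal_ne_top
  set ρ : (Fin d → ZMod M) → ℝ≥0∞ := fun b => ∑ y ∈ S, f y * h (b - proj d M y) with hρ
  have hle : ∀ b, h b ≤ pushforward (proj d M) f b + ρ b := by
    intro b
    refine (ENNReal.ofReal_le_ofReal (torusTau_le_add hβ hL hM b)).trans ?_
    have hτ : ∀ v, 0 ≤ torusTau d M β v := fun v => twoPoint_nonneg hβ _ _ _
    rw [ENNReal.ofReal_add (Finset.sum_nonneg fun a _ => tau_nonneg hβ a)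
      (Finset.sum_nonneg fun y _ => mul_nonneg (tau_nonneg hβ y) (hτ _)),
      ENNReal.ofReal_sum_of_nonneg fun a _ => tau_nonneg hβ a,
      ENNReal.ofReal_sum_of_nonneg fun y _ => mul_nonneg (tau_nonneg hβ y) (hτ _)]
    refine add_le_add ?_ (le_of_eq (Finset.sum_congr rfl fun y _ =>
      ENNReal.ofReal_mul (tau_nonneg hβ y)))
    refine le_trans (le_of_eq ?_) (sum_ite_le_tsum (box d L) f fun a => proj d M a = b)
    congr!
  have hρsum : ∑' b, ρ b = φ * H := by
    rw [hρ, tsum_fintype, Finset.sum_comm, hφdef, Finset.sum_mul]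
    refine Finset.sum_congr rfl fun y _ => ?_
    rw [← Finset.mul_sum, hHdef, tsum_fintype]
    congr 1
    exact Fintype.sum_equiv (Equiv.subRight (proj d M y)) _ _ fun _ => rfl
  have hHle : H ≤ χ + φ * H := by
    rw [← hρsum, hχdef, ← tsum_pushforward (proj d M) f, ← ENNReal.tsum_add]
    exact ENNReal.tsum_le_tsum hle
  have hH2 : H ≤ 2 * χ := by
    have h1 : H / 2 + H / 2 ≤ χ + H / 2 := by
      rw [ENNReal.add_halves]
      refine hHle.trans (add_le_add le_rfl ?_)
      rw [div_eq_mul_inv, mul_comm]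
      exact mul_le_mul' le_rfl (hφ.trans (min_le_left _ _))
    have h2 : H / 2 ≤ χ := by
      rwa [ENNReal.add_le_add_iff_right (ENNReal.div_ne_top hH two_ne_zero)] at h1
    calc H = H / 2 + H / 2 := (ENNReal.add_halves H).symm
      _ ≤ χ + χ := add_le_add h2 h2
      _ = 2 * χ := (two_mul χ).symm
  refine ⟨ρ, ?_, hle⟩
  rw [hρsum]
  calc φ * H ≤ ε / (2 * χ + 1) * (2 * χ + 1) :=
        mul_le_mul' (hφ.trans (min_le_right _ _)) (hH2.trans le_self_add)
    _ ≤ ε := ENNReal.mul_le_of_le_div le_rfl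

/-- Comparison of a torus and a larger torus which covers it. -/
theorem torusTau_covering (hβ : 0 < β) {r M : ℕ} [NeZero r] [NeZero M] (hr : 3 ≤ r) (hrM : r ∣ M)
    (x : Fin d → ZMod r) :
    ENNReal.ofReal (torusTau d r β x)
      ≤ pushforward ((ZMod.castHom hrM (ZMod r)).toAddMonoidHom.compLeft (Fin d))
          (fun b => ENNReal.ofReal (torusTau d M β b)) x ∧
    pushforward ((ZMod.castHom hrM (ZMod r)).toAddMonoidHom.compLeft (Fin d))
        (fun b => ENNReal.ofReal (torusTau d M β b)) x
      ≤ ENNReal.ofReal (torusTau d r β x)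
        + errorSum ((ZMod.castHom hrM (ZMod r)).toAddMonoidHom.compLeft (Fin d))
          (fun b => ENNReal.ofReal (torusTau d M β b))
          (fun v => ENNReal.ofReal (torusTau d r β v)) x := by
  have : Fact (1 < r) := ⟨by omega⟩
  have : Fact (2 < r) := ⟨by omega⟩
  set f := ZMod.castHom hrM (ZMod r) with hf
  have hfp : ∀ v : Fin d → ZMod M, f.toAddMonoidHom.compLeft (Fin d) v = f ∘ v := fun v => rfl
  obtain ⟨h1, h2⟩ := twoPoint_covering (d := d) f ZMod.neg_one_ne_one.symm hβ x
  have hτr : ∀ v, 0 ≤ torusTau d r β v := fun v => twoPoint_nonneg hβ _ _ _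
  have hτM : ∀ v, 0 ≤ torusTau d M β v := fun v => twoPoint_nonneg hβ _ _ _
  replace h1 : torusTau d r β x ≤ ∑ x' : Fin d → ZMod M with f ∘ x' = x, torusTau d M β x' := by
    simp only [torusTau]
    convert h1
  replace h2 : ∑ x' : Fin d → ZMod M with f ∘ x' = x, torusTau d M β x'
      ≤ torusTau d r β x
        + ∑ x' : Fin d → ZMod M with f ∘ x' = x, ∑ y : Fin d → ZMod M,
          ∑ y' : Fin d → ZMod M with y' ≠ y ∧ f ∘ y' = f ∘ y, ∑ z : Fin d → ZMod M,
          torusTau d M β z * torusTau d M β (y - z) * torusTau d M β (y' - z)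
            * torusTau d r β (f ∘ y' - f ∘ z) * torusTau d M β (x' - y) := by
    simp only [torusTau]
    convert h2
  have hpush : pushforward (f.toAddMonoidHom.compLeft (Fin d))
      (fun b => ENNReal.ofReal (torusTau d M β b)) x
      = ENNReal.ofReal (∑ x' : Fin d → ZMod M with f ∘ x' = x, torusTau d M β x') := by
    rw [ENNReal.ofReal_sum_of_nonneg fun v _ => hτM v, pushforward, tsum_fintype,
      Finset.sum_filter]
    simp only [hfp]
  rw [hpush]
  refine ⟨ENNReal.ofReal_le_ofReal h1, (ENNReal.ofReal_le_ofReal h2).trans ?_⟩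
  have hnn : ∀ x' y y' z : Fin d → ZMod M,
      0 ≤ torusTau d M β z * torusTau d M β (y - z) * torusTau d M β (y' - z)
        * torusTau d r β (f ∘ y' - f ∘ z) * torusTau d M β (x' - y) := fun x' y y' z =>
    mul_nonneg (mul_nonneg (mul_nonneg (mul_nonneg (hτM _) (hτM _)) (hτM _)) (hτr _)) (hτM _)
  refine ENNReal.ofReal_add_le.trans (add_le_add le_rfl ?_)
  rw [ENNReal.ofReal_sum_of_nonneg fun x' _ => Finset.sum_nonneg fun y _ =>
    Finset.sum_nonneg fun y' _ => Finset.sum_nonneg fun z _ => hnn x' y y' z, errorSum,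
    tsum_fintype, Finset.sum_filter]
  refine Finset.sum_le_sum fun x' _ => ?_
  by_cases hx' : f ∘ x' = x
  · rw [if_pos hx', tsum_fintype, ENNReal.ofReal_sum_of_nonneg fun y _ =>
      Finset.sum_nonneg fun y' _ => Finset.sum_nonneg fun z _ => hnn x' y y' z]
    refine Finset.sum_le_sum fun y _ => ?_
    rw [tsum_fintype, ENNReal.ofReal_sum_of_nonneg fun y' _ =>
      Finset.sum_nonneg fun z _ => hnn x' y y' z, Finset.sum_filter]
    refine Finset.sum_le_sum fun y' _ => ?_
    by_cases hy' : y' ≠ y ∧ f ∘ y' = f ∘ y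
    · rw [if_pos hy', tsum_fintype, ENNReal.ofReal_sum_of_nonneg fun z _ => hnn x' y y' z]
      refine Finset.sum_le_sum fun z _ => ?_
      simp only [hfp]
      rw [if_pos ⟨hx', hy'.2, hy'.1⟩, ENNReal.ofReal_mul', ENNReal.ofReal_mul',
        ENNReal.ofReal_mul', ENNReal.ofReal_mul']
      all_goals first | exact hτM _ | exact hτr _
    · rw [if_neg hy']
      exact zero_le
  · rw [if_neg hx']
    exact zero_le

/-- The projection `π` as a homomorphism. -/
def projHom (d r : ℕ) : (Fin d → ℤ) →+ (Fin d → ZMod r) :=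
  (Int.castRingHom (ZMod r)).toAddMonoidHom.compLeft (Fin d)

theorem projHom_apply (r : ℕ) (x : Fin d → ℤ) : projHom d r x = proj d r x := rfl

theorem castHom_projHom {r M : ℕ} (hrM : r ∣ M) (x : Fin d → ℤ) :
    (ZMod.castHom hrM (ZMod r)).toAddMonoidHom.compLeft (Fin d) (projHom d M x)
      = projHom d r x := by
  ext i
  exact map_intCast (ZMod.castHom hrM (ZMod r)) (x i)

theorem pushforward_le_of_sum_le {A B : Type*} [DecidableEq B] (p : A → B) (f : A → ℝ≥0∞) (b : B)
    {c : ℝ≥0∞} (h : ∀ F : Finset A, ∑ a ∈ F, (if p a = b then f a else 0) ≤ c) :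
    pushforward p f b ≤ c := by
  rw [pushforward, ENNReal.tsum_eq_iSup_sum]
  refine iSup_le fun F => le_trans (le_of_eq ?_) (h F)
  congr!

theorem pushforward_le_of_le {A B : Type*} (p : A → B) {f h ρ : A → ℝ≥0∞}
    (hh : ∀ a, h a ≤ f a + ρ a) (b : B) :
    pushforward p h b ≤ pushforward p f b + ∑' a, ρ a := by
  rw [pushforward, pushforward, ← ENNReal.tsum_add]
  refine ENNReal.tsum_le_tsum fun a => ?_
  split_ifs
  · exact hh a
  · exact zero_le

/-- Lower bound for the fibre sums of a large torus. -/
theorem sum_boxTwoPoint_le (hβ : 0 < β) {r M : ℕ} [NeZero M] (hM : 2 ≤ M) (hrM : r ∣ M)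
    {F : Finset (Fin d → ℤ)} (hF : F ⊆ box d M) (x : Fin d → ZMod r) :
    ∑ a ∈ F, (if projHom d r a = x then ENNReal.ofReal (boxTwoPoint d M β 0 a) else 0)
      ≤ pushforward ((ZMod.castHom hrM (ZMod r)).toAddMonoidHom.compLeft (Fin d))
          (fun b => ENNReal.ofReal (torusTau d M β b)) x := by
  set p := (ZMod.castHom hrM (ZMod r)).toAddMonoidHom.compLeft (Fin d) with hp
  have hinj : Set.InjOn (projHom d M) F := (proj_injOn_box (d := d) (M := M)).mono hF
  refine le_trans ?_ (ENNReal.sum_le_tsum (F.image (projHom d M)))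
  rw [Finset.sum_image hinj]
  refine Finset.sum_le_sum fun a _ => ?_
  rw [hp, castHom_projHom]
  split_ifs
  · exact ENNReal.ofReal_le_ofReal (boxTwoPoint_le_torusTau hβ hM a)
  · exact le_rfl

/-- Compare with a covering torus whose side is a large multiple of `r`: its two-point function is
at most the projection of `tau` plus a remainder of total mass `ε`, and projections compose. -/
theorem torusTau_le_unfolded (hβ : 0 < β) {r : ℕ} [NeZero r] (hr : 3 ≤ r)
    (hχ : ∑' x : Fin d → ℤ, ENNReal.ofReal (tau d β x) ≠ ∞) (x : Fin d → ZMod r) :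
    ENNReal.ofReal (torusTau d r β x)
      ≤ pushforward (projHom d r) (fun a => ENNReal.ofReal (tau d β a)) x := by
  refine ENNReal.le_of_forall_pos_le_add fun ε hε _ => ?_
  obtain ⟨M₀, hM₀⟩ := exists_torusTau_le_pushforward hβ hχ (ENNReal.coe_ne_zero.2 hε.ne')
  have : NeZero ((M₀ + 1) * r) := ⟨mul_ne_zero (Nat.succ_ne_zero _) (NeZero.ne r)⟩
  obtain ⟨ρ, hρ, hle⟩ := hM₀ ((M₀ + 1) * r) (by nlinarith)
  refine (torusTau_covering hβ hr (Dvd.intro_left _ rfl) x).1.trans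
    ((pushforward_le_of_le _ hle x).trans (add_le_add (le_of_eq ?_) hρ))
  change pushforward _ (pushforward (projHom d _) _) x = _
  rw [pushforward_comp]
  congr 1
  ext1 a
  exact castHom_projHom _ a

/-- For fixed `δ`, a finite part of the fibre fits in a large box, and box correlations are at most
those of the covering torus, whose error is within `δ` in each pair sum. The side tends to infinity
first, then `δ` to `0`. -/
theorem unfolded_le_add_errorSum (hβ : 0 < β) {r : ℕ} [NeZero r] (hr : 3 ≤ r)
    (hχ : ∑' x : Fin d → ℤ, ENNReal.ofReal (tau d β x) ≠ ∞) (x : Fin d → ZMod r) :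
    pushforward (projHom d r) (fun a => ENNReal.ofReal (tau d β a)) x
      ≤ ENNReal.ofReal (torusTau d r β x) + errorSum (projHom d r)
        (fun a => ENNReal.ofReal (tau d β a)) (fun v => ENNReal.ofReal (torusTau d r β v)) x := by
  set f : (Fin d → ℤ) → ℝ≥0∞ := fun a => ENNReal.ofReal (tau d β a) with hf
  set g : (Fin d → ZMod r) → ℝ≥0∞ := fun v => ENNReal.ofReal (torusTau d r β v) with hg
  set χ := ∑' a, f a with hχdef
  set P : (Fin d → ZMod r) → ℝ≥0∞ := fun v =>
    pairSum f (fun a b => projHom d r a = v ∧ projHom d r b = v ∧ b ≠ a) with hP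
  set Q : (Fin d → ZMod r) → ℝ≥0∞ := fun v =>
    pairSum f (fun a b => projHom d r a + projHom d r b = x - v) with hQ
  have hχ1 : 2 * χ + 1 ≠ ∞ :=
    ENNReal.add_ne_top.2 ⟨ENNReal.mul_ne_top ENNReal.ofNat_ne_top hχ, ENNReal.one_ne_top⟩
  have hstep : ∀ δ : ℝ≥0∞, 0 < δ →
      pushforward (projHom d r) f x ≤ g x + ∑' v, g v * ((P v + δ) * (Q v + δ)) := by
    intro δ hδ
    -- If the mass `m` of the remainder is at most `1` and `δ / (2χ + 1)`, then `m (2χ + m) ≤ δ`.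
    obtain ⟨M₀, hM₀⟩ := exists_torusTau_le_pushforward hβ hχ
      (lt_min one_pos (ENNReal.div_pos hδ.ne' hχ1)).ne'
    refine pushforward_le_of_sum_le _ _ _ fun F => ?_
    have hlim : Tendsto (fun N : ℕ => ∑ a ∈ F, if projHom d r a = x then
        ENNReal.ofReal (boxTwoPoint d ((N + 1) * r) β 0 a) else 0) atTop
        (nhds (∑ a ∈ F, if projHom d r a = x then f a else 0)) := by
      refine tendsto_finsetSum F fun a _ => ?_
      split_ifs
      · refine ENNReal.tendsto_ofReal ((tendsto_boxTwoPoint hβ a).comp ?_)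
        exact (tendsto_add_atTop_nat 1).atTop_mul_const' (by omega)
      · exact tendsto_const_nhds
    have hev := (tendsto_id.atTop_mul_const' (by omega : 0 < r)).comp (tendsto_add_atTop_nat 1)
    refine le_of_tendsto hlim ?_
    filter_upwards [hev.eventually (eventually_subset_box F), eventually_ge_atTop M₀] with N hF hN
    have : NeZero ((N + 1) * r) := ⟨mul_ne_zero (Nat.succ_ne_zero _) (NeZero.ne r)⟩
    obtain ⟨ρ, hρ, hle⟩ := hM₀ ((N + 1) * r) (by nlinarith)
    have hrM : r ∣ (N + 1) * r := Dvd.intro_left _ rfl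
    refine (sum_boxTwoPoint_le hβ (by nlinarith) hrM hF x).trans
      ((torusTau_covering hβ hr hrM x).2.trans (add_le_add le_rfl ?_))
    have herr := errorSum_le_of_le_pushforward (projHom d ((N + 1) * r))
      ((ZMod.castHom hrM (ZMod r)).toAddMonoidHom.compLeft (Fin d)) f
      (fun b => ENNReal.ofReal (torusTau d ((N + 1) * r) β b)) ρ hle g x (δ := δ) (by
        refine (mul_le_mul' (hρ.trans (min_le_right _ _))
          (add_le_add le_rfl (hρ.trans (min_le_left _ _)))).trans ?_
        exact ENNReal.mul_le_of_le_div le_rfl)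
    simp only [castHom_projHom] at herr
    exact herr
  rw [errorSum_eq]
  -- Multiplication on `[0, ∞]` is continuous at these limits because finite susceptibility bounds
  -- the pair sums.
  have hpair : ∀ R : (Fin d → ℤ) → (Fin d → ℤ) → Prop, pairSum f R ≠ ∞ := fun R =>
    ((pairSum_le f R).trans_lt (ENNReal.mul_lt_top hχ.lt_top hχ.lt_top)).ne
  have hlim : Tendsto (fun δ : ℝ≥0∞ => g x + ∑' v, g v * ((P v + δ) * (Q v + δ)))
      (nhdsWithin 0 (Set.Ioi 0)) (nhds (g x + ∑' v, g v * (P v * Q v))) := by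
    simp only [tsum_fintype]
    refine tendsto_const_nhds.add (tendsto_finsetSum _ fun v _ => ?_)
    have hid : Tendsto (fun δ : ℝ≥0∞ => δ) (nhdsWithin 0 (Set.Ioi 0)) (nhds 0) :=
      tendsto_id.mono_left nhdsWithin_le_nhds
    have h1 : Tendsto (fun δ => P v + δ) (nhdsWithin 0 (Set.Ioi 0)) (nhds (P v)) := by
      simpa using tendsto_const_nhds.add hid
    have h2 : Tendsto (fun δ => Q v + δ) (nhdsWithin 0 (Set.Ioi 0)) (nhds (Q v)) := by
      simpa using tendsto_const_nhds.add hid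
    exact ENNReal.Tendsto.const_mul
      (ENNReal.Tendsto.mul h1 (Or.inr (hpair _)) h2 (Or.inr (hpair _)))
      (Or.inr ENNReal.ofReal_ne_top)
  refine ge_of_tendsto hlim ?_
  filter_upwards [self_mem_nhdsWithin] with δ hδ
  exact hstep δ hδ

end Limit

/-! ### Return to the lattice sums, and the case of infinite susceptibility -/

section Final

open scoped Classical

variable {d r : ℕ} {β : ℝ}

theorem equivalent_iff {x x' : Fin d → ℤ} : Equivalent r x' x ↔ projHom d r x' = projHom d r x := by
  constructor
  · rintro ⟨u, hu⟩
    rw [sub_eq_iff_eq_add.1 hu]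
    ext i
    simp [projHom_apply, proj]
  · intro h
    have hdvd : ∀ i, (r : ℤ) ∣ x' i - x i := fun i =>
      (ZMod.intCast_eq_intCast_iff_dvd_sub (x i) (x' i) r).1 (congrFun h i).symm
    choose u hu using hdvd
    exact ⟨u, funext fun i => by simpa using hu i⟩

theorem unfolded_eq (hr : r ≠ 0) (x : Fin d → ℤ) : unfolded d r β x
    = pushforward (projHom d r) (fun a => ENNReal.ofReal (tau d β a)) (projHom d r x) := by
  have hinj : Function.Injective fun u : Fin d → ℤ => x + (r : ℤ) • u := fun u v huv => by
    have h1 := add_left_cancel huv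
    exact smul_right_injective _ (Int.natCast_ne_zero.2 hr) h1
  rw [pushforward, ← hinj.tsum_eq, unfolded]
  · refine tsum_congr fun u => ?_
    rw [if_pos]
    exact equivalent_iff.1 ⟨u, by simp⟩
  · intro a ha
    have h1 : projHom d r a = projHom d r x := by
      by_contra h
      exact ha (if_neg h)
    obtain ⟨u, hu⟩ := equivalent_iff.2 h1
    exact ⟨u, by simp [← hu]⟩

theorem tsum_eq_errorSum (g : (Fin d → ZMod r) → ℝ≥0∞) (f : (Fin d → ℤ) → ℝ≥0∞)
    (x : Fin d → ℤ) :
    ∑' x' : {x' : Fin d → ℤ // Equivalent r x' x}, ∑' y : Fin d → ℤ,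
      ∑' y' : {y' : Fin d → ℤ // Equivalent r y' y ∧ y' ≠ y}, ∑' z : Fin d → ℤ,
        f z * f (y - z) * f (y'.1 - z) * g (proj d r y'.1 - proj d r z) * f (x'.1 - y)
      = errorSum (projHom d r) f g (projHom d r x) := by
  rw [tsum_subtype_eq_ite (fun x' => Equivalent r x' x) fun x' => ∑' y : Fin d → ℤ,
      ∑' y' : {y' : Fin d → ℤ // Equivalent r y' y ∧ y' ≠ y}, ∑' z : Fin d → ℤ,
        f z * f (y - z) * f (y'.1 - z) * g (proj d r y'.1 - proj d r z) * f (x' - y)]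
  refine tsum_congr fun x' => ?_
  by_cases hx : projHom d r x' = projHom d r x
  · rw [if_pos (equivalent_iff.2 hx)]
    refine tsum_congr fun y => ?_
    rw [tsum_subtype_eq_ite (fun y' => Equivalent r y' y ∧ y' ≠ y) fun y' => ∑' z : Fin d → ℤ,
        f z * f (y - z) * f (y' - z) * g (proj d r y' - proj d r z) * f (x' - y)]
    refine tsum_congr fun y' => ?_
    by_cases hy : projHom d r y' = projHom d r y ∧ y' ≠ y
    · rw [if_pos ⟨equivalent_iff.2 hy.1, hy.2⟩]
      refine tsum_congr fun z => ?_
      rw [if_pos ⟨hx, hy⟩]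
      rfl
    · rw [if_neg fun h => hy ⟨equivalent_iff.1 h.1, h.2⟩]
      simp only [hy, and_false, if_false, tsum_zero]
  · rw [if_neg fun h => hx (equivalent_iff.1 h)]
    simp only [hx, false_and, if_false, tsum_zero]

theorem ofReal_tau_pos (hβ : 0 < β) (x : Fin d → ℤ) : 0 < ENNReal.ofReal (tau d β x) :=
  ENNReal.ofReal_pos.2 (tau_pos hβ x)

theorem projHom_surjective (d r : ℕ) : Function.Surjective (projHom d r) := by
  intro v
  choose w hw using fun i => ZMod.intCast_surjective (v i)
  exact ⟨w, funext hw⟩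

/-- If one of the unfolded sums is finite, then the susceptibility is finite. -/
theorem tsum_tau_ne_top (hβ : 0 < β) [NeZero r] (x : Fin d → ℤ)
    (h : pushforward (projHom d r) (fun a => ENNReal.ofReal (tau d β a)) (projHom d r x) ≠ ∞) :
    ∑' a : Fin d → ℤ, ENNReal.ofReal (tau d β a) ≠ ∞ := by
  rw [← tsum_pushforward (projHom d r), tsum_fintype]
  refine ENNReal.sum_ne_top.2 fun v _ htop => ?_
  obtain ⟨w, rfl⟩ := projHom_surjective d r v
  -- Supermultiplicativity of `tau` along the shift `x - w` compares two fibres, and `tau (x - w)`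
  -- is positive; one infinite fibre sum would make all of them infinite.
  have hle : pushforward (projHom d r) (fun a => ENNReal.ofReal (tau d β a)) (projHom d r w)
      * ENNReal.ofReal (tau d β (x - w))
      ≤ pushforward (projHom d r) (fun a => ENNReal.ofReal (tau d β a)) (projHom d r x) := by
    rw [pushforward, pushforward, ← ENNReal.tsum_mul_right]
    refine le_trans ?_ ((Equiv.addRight (x - w)).tsum_eq _).le
    refine ENNReal.tsum_le_tsum fun a => ?_
    split_ifs with h1 h2
    · rw [← ENNReal.ofReal_mul (tau_nonneg hβ a)]
      exact ENNReal.ofReal_le_ofReal (tau_mul_le hβ a (x - w))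
    · refine absurd ?_ h2
      rw [Equiv.coe_addRight, map_add, map_sub, h1]
      abel
    · rw [zero_mul]
      exact zero_le
    · rw [zero_mul]
  rw [htop, ENNReal.top_mul (ofReal_tau_pos hβ _).ne'] at hle
  exact h (top_le_iff.1 hle)

/-- The terms `y = z = 0`, `y' = y₁` alone contribute `tau y₁` times the unfolded sum. A nonzero
`y₁` in `r ℤ^d` exists because `d ≥ 1`. -/
theorem errorSum_eq_top (hβ : 0 < β) (hd : 1 ≤ d) [NeZero r] (x : Fin d → ZMod r)
    (h : pushforward (projHom d r) (fun a => ENNReal.ofReal (tau d β a)) x = ∞) :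
    errorSum (projHom d r) (fun a => ENNReal.ofReal (tau d β a))
      (fun v => ENNReal.ofReal (torusTau d r β v)) x = ∞ := by
  set f : (Fin d → ℤ) → ℝ≥0∞ := fun a => ENNReal.ofReal (tau d β a) with hf
  set y₁ : Fin d → ℤ := Pi.single ⟨0, hd⟩ (r : ℤ) with hy₁
  have hy0 : y₁ ≠ 0 := by
    rw [hy₁, Ne, Pi.single_eq_zero_iff]
    exact Int.natCast_ne_zero.2 (NeZero.ne r)
  have hp : projHom d r y₁ = 0 := by
    ext i
    by_cases hi : i = ⟨0, hd⟩
    · subst hi; simp [projHom_apply, proj, hy₁]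
    · simp [projHom_apply, proj, hy₁, hi]
  have hf0 : f 0 = 1 := by rw [hf]; simp only [tau_zero hβ, ENNReal.ofReal_one]
  have hg0 : torusTau d r β 0 = 1 := twoPoint_self hβ _ _
  have hterm : f y₁ * pushforward (projHom d r) f x ≤ errorSum (projHom d r) f
      (fun v => ENNReal.ofReal (torusTau d r β v)) x := by
    rw [pushforward, ← ENNReal.tsum_mul_left]
    refine ENNReal.tsum_le_tsum fun x' => ?_
    refine le_trans ?_ (ENNReal.le_tsum 0)
    refine le_trans ?_ (ENNReal.le_tsum y₁)
    refine le_trans ?_ (ENNReal.le_tsum 0)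
    by_cases hx : projHom d r x' = x
    · rw [if_pos hx, if_pos ⟨hx, by rw [hp, map_zero], hy0⟩, hp, map_zero, sub_zero, sub_zero,
        sub_zero, sub_zero, hf0]
      simp [hg0]
    · rw [if_neg hx, mul_zero]
      exact zero_le
  rw [h, ENNReal.mul_top (ofReal_tau_pos hβ _).ne'] at hterm
  exact top_le_iff.1 hterm

end Final

end IsingTorus

end

theorem theorem2p1 (d : ℕ) (hd : 1 ≤ d) (r : ℕ) [NeZero r] (hr : 3 ≤ r) (β : ℝ) (hβ : 0 < β)
    (x : Fin d → ℤ) (hx : x ∈ IsingTorus.box d r) :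
    ENNReal.ofReal (IsingTorus.torusTau d r β (IsingTorus.proj d r x))
        ≤ IsingTorus.unfolded d r β x ∧
      IsingTorus.unfolded d r β x
          - ENNReal.ofReal (IsingTorus.torusTau d r β (IsingTorus.proj d r x))
        ≤ ∑' x' : {x' : Fin d → ℤ // IsingTorus.Equivalent r x' x},
          ∑' y : Fin d → ℤ,
          ∑' y' : {y' : Fin d → ℤ // IsingTorus.Equivalent r y' y ∧ y' ≠ y},
          ∑' z : Fin d → ℤ,
            ENNReal.ofReal (IsingTorus.tau d β z)
              * ENNReal.ofReal (IsingTorus.tau d β (y - z))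
              * ENNReal.ofReal (IsingTorus.tau d β (y'.1 - z))
              * ENNReal.ofReal (IsingTorus.torusTau d r β
                  (IsingTorus.proj d r y'.1 - IsingTorus.proj d r z))
              * ENNReal.ofReal (IsingTorus.tau d β (x'.1 - y)) := by
  rw [IsingTorus.tsum_eq_errorSum (fun v => ENNReal.ofReal (IsingTorus.torusTau d r β v))
    (fun a => ENNReal.ofReal (IsingTorus.tau d β a)) x, IsingTorus.unfolded_eq (NeZero.ne r),
    ← IsingTorus.projHom_apply]
  -- An infinite unfolded sum makes both right-hand sides infinite; a finite one forces finite
  -- susceptibility, which the limiting argument needs.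
  by_cases h : IsingTorus.pushforward (IsingTorus.projHom d r)
      (fun a => ENNReal.ofReal (IsingTorus.tau d β a)) (IsingTorus.projHom d r x) = ∞
  · rw [IsingTorus.errorSum_eq_top hβ hd _ h, h]
    exact ⟨le_top, le_top⟩
  · have hχ := IsingTorus.tsum_tau_ne_top hβ x h
    exact ⟨IsingTorus.torusTau_le_unfolded hβ hr hχ _,
      tsub_le_iff_left.2 (IsingTorus.unfolded_le_add_errorSum hβ hr hχ _)⟩
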